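/- Let $M_N$ be the space of real $N\times N$ matrices with the Schatten $p$-(quasi-)norm $\|X\|_{S_p}=\big(\sum_{i=1}^N\sigma_i(X)^p\big)^{1/p}$, where $\sigma_i(X)$ are the singular values of $X$, and let $\rho_s(X)_{S_p}=\inf\{\|X-Y\|_{S_p}:\operatorname{rank}(Y)\le s\}$. For a linear map $\mathcal A:M_N\to\mathbb R^m$ and $k\ge 1$, let $\alpha_k,\beta_k\ge 0$ be the best constants in $\alpha_k\|Z\|_{S_2}\le\|\mathcal AZ\|_{\ell_2}\le\beta_k\|Z\|_{S_2}$ for all $Z\in M_N$ with $\operatorname{rank}(Z)\le k$, and, when $\alpha_k>0$, put $\gamma_k=\beta_k^2/\alpha_k^2$. For $y\in\mathbb R^m$ let $(P_p)$ be the problem: minimize $\|Z\|_{S_p}$ subject to $\mathcal AZ=y$. There are functions $C_1,C_2$ of three real variables such that the following holds for all $0<p\le 1$, all $N,m$, all integers $t\ge s\ge 1$, and every linear $\mathcal A:M_N\to\mathbb R^m$ with $\alpha_{2t}>0$ and $$\gamma_{2t}-1<4(\sqrt2-1)\left(\frac ts\right)^{1/p-1/2}.$$ (Exact recovery) For every $X\in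 M_N$ with $\operatorname{rank}(X)\le s$, the unique solution of $(P_p)$ with $y=\mathcal AX$ is $X$. (Stable recovery) For every $X\in M_N$, the problem $(P_p)$ with $y=\mathcal AX$ has a solution, and every solution $X^*$ satisfies $$\|X-X^*\|_{S_p}\le C_1\,\rho_s(X)_{S_p},\qquad \|X-X^*\|_{S_2}\le C_2\,\frac{\rho_s(X)_{S_p}}{t^{1/p-1/2}},$$ where $C_i=C_i(p,\gamma_{2t},s/t)$ depends only on $p$, $\gamma_{2t}$ and the ratio $s/t$. -/

import Mathlib

noncomputable section

namespace SchattenRecovery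

/-- The Schatten `p`-(quasi-)norm `(∑ σᵢ(X)^p)^(1/p)` of a real `N × N` matrix, where `σᵢ(X)`,
`0 ≤ i < N`, are the singular values of `X` as a map of Euclidean spaces. -/
def schattenNorm {N : ℕ} (p : ℝ) (X : Matrix (Fin N) (Fin N) ℝ) : ℝ :=
  (∑ i : Fin N, ((Matrix.toEuclideanLin X).singularValues (i : ℕ)) ^ p) ^ (1 / p)

/-- The best rank-`s` approximation error of `X` in the Schatten `p`-(quasi-)norm. -/
def rankError {N : ℕ} (p : ℝ) (s : ℕ) (X : Matrix (Fin N) (Fin N) ℝ) : ℝ :=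
  sInf {r : ℝ | ∃ Y : Matrix (Fin N) (Fin N) ℝ, Y.rank ≤ s ∧ r = schattenNorm p (X - Y)}

/-- `α_k`: the largest `a ≥ 0` with `a ‖Z‖_{S₂} ≤ ‖A Z‖₂` for all `Z` of rank at most `k`. -/
def lowerConst {N m : ℕ} (A : Matrix (Fin N) (Fin N) ℝ →ₗ[ℝ] EuclideanSpace ℝ (Fin m))
    (k : ℕ) : ℝ :=
  sSup {a : ℝ | 0 ≤ a ∧ ∀ Z : Matrix (Fin N) (Fin N) ℝ, Z.rank ≤ k →
    a * schattenNorm 2 Z ≤ ‖A Z‖}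

/-- `β_k`: the smallest `b ≥ 0` with `‖A Z‖₂ ≤ b ‖Z‖_{S₂}` for all `Z` of rank at most `k`. -/
def upperConst {N m : ℕ} (A : Matrix (Fin N) (Fin N) ℝ →ₗ[ℝ] EuclideanSpace ℝ (Fin m))
    (k : ℕ) : ℝ :=
  sInf {b : ℝ | 0 ≤ b ∧ ∀ Z : Matrix (Fin N) (Fin N) ℝ, Z.rank ≤ k →
    ‖A Z‖ ≤ b * schattenNorm 2 Z}

/-- `γ_k = β_k² / α_k²`, meaningful when `α_k > 0`. -/
def gammaConst {N m : ℕ} (A : Matrix (Fin N) (Fin N) ℝ →ₗ[ℝ] EuclideanSpace ℝ (Fin m))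
    (k : ℕ) : ℝ :=
  upperConst A k ^ 2 / lowerConst A k ^ 2

/-- `X` is a solution of: minimize `‖Z‖_{S_p}` subject to `A Z = y`. -/
def IsSolution {N m : ℕ} (p : ℝ)
    (A : Matrix (Fin N) (Fin N) ℝ →ₗ[ℝ] EuclideanSpace ℝ (Fin m))
    (y : EuclideanSpace ℝ (Fin m)) (X : Matrix (Fin N) (Fin N) ℝ) : Prop :=
  A X = y ∧ ∀ Z : Matrix (Fin N) (Fin N) ℝ, A Z = y → schattenNorm p X ≤ schattenNorm p Z

end SchattenRecovery

end

/-! Let `X'` be a minimiser and V = X - X', so that A V = 0. Call the sum of the p-th powers of the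
first s singular values the head, and the sum of the others the tail. Two facts about V suffice.

(1) Minimality gives tail(V) ≤ head(V) + 2 tail(X). This follows from the concave Mirsky inequality
∑ |σᵢ(X)^p - σᵢ(Y)^p| ≤ ∑ σᵢ(X - Y)^p, which compares singular values without aligning singular
vectors (`sum_abs_rpow_singularValues_sub_le`, `schattenTail_sub_le`). For a rank-one perturbation
of size e, one symmetric operator of trace e dominates the self-adjoint dilations of both maps,
which gives the case p = 1. The singular values also interlace, so the gaps are disjoint intervals,
and concavity gives the bound e^p. Adding the rank-one terms of a singular value decomposition one
at a time gives the general case.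

(2) The null space property: head(V) ≤ λ tail(V) with λ < 1 (`schattenHead_le_of_map_eq_zero`). With
the singular vectors of V fixed, coefficient vectors map isometrically into the Schatten 2-norm, and
k-sparse ones go to rank at most k. The claim is thus one about a decreasing vector in the kernel of
a restricted isometry of ℝ^N. Cut it into a block of length s followed by blocks of length t. Images
of distinct blocks are nearly orthogonal, and each block after the second is controlled in ℓ₂ by the
ℓ_p mass of its predecessor.

Together these give tail(V) ≤ 2/(1 - λ) · tail(X), and tail(X)^(1/p) ≤ ρ_s(X). The hypothesis on γ
is exactly λ < 1, because (1 + √2)(√2 - 1) = 1. -/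

noncomputable section

open Module

namespace SchattenRecovery

/-! ### Singular value decomposition and min-max bounds. -/

section

variable {E : Type*} [NormedAddCommGroup E] [InnerProductSpace ℝ E]
  {n : ℕ}

/-- The norm of `T x` in terms of a singular value decomposition. -/
theorem norm_sq_apply_of_svd {T : E →ₗ[ℝ] E} {u v : OrthonormalBasis (Fin n) ℝ E}
    {σ : Fin n → ℝ} (h : ∀ i, T (v i) = σ i • u i) (x : E) :
    ‖T x‖ ^ 2 = ∑ i, (σ i * inner ℝ (v i) x) ^ 2 := by
  have h1 : T x = ∑ i, (σ i * inner ℝ (v i) x) • u i := by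
    conv_lhs => rw [← v.sum_repr' x]
    rw [map_sum]
    refine Finset.sum_congr rfl fun i _ => ?_
    rw [map_smul, h, smul_smul, mul_comm]
  rw [← u.sum_sq_norm_inner_right, h1]
  refine Finset.sum_congr rfl fun i _ => ?_
  rw [u.orthonormal.inner_right_fintype, Real.norm_eq_abs, sq_abs]

theorem norm_sq_eq_sum_inner (v : OrthonormalBasis (Fin n) ℝ E) (x : E) :
    ‖x‖ ^ 2 = ∑ i, (inner ℝ (v i) x) ^ 2 := by
  rw [← v.sum_sq_norm_inner_right]
  simp

theorem inner_eq_zero_of_mem_span (v : OrthonormalBasis (Fin n) ℝ E) {s : Set (Fin n)} {x : E}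
    (hx : x ∈ Submodule.span ℝ (v '' s)) {j : Fin n} (hj : j ∉ s) : inner ℝ (v j) x = 0 := by
  induction hx using Submodule.span_induction with
  | mem y hy =>
    obtain ⟨i, hi, rfl⟩ := hy
    rw [v.inner_eq_ite, if_neg]
    rintro rfl
    exact hj hi
  | zero => simp
  | add y z _ _ hy hz => rw [inner_add_right, hy, hz, add_zero]
  | smul c y _ hy => rw [inner_smul_right, hy, mul_zero]

theorem finrank_span_image (v : OrthonormalBasis (Fin n) ℝ E) (s : Finset (Fin n)) :
    finrank ℝ (Submodule.span ℝ (v '' (s : Set (Fin n)))) = s.card := by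
  classical
  have h := finrank_span_finset_eq_card (R := ℝ) (s := s.image v) (by
    rw [Finset.coe_image]
    exact (v.orthonormal.linearIndependent.linearIndepOn (s := (s : Set (Fin n)))).id_image)
  rw [Finset.coe_image, Finset.card_image_of_injective _ v.orthonormal.linearIndependent.injective] at h
  exact h

variable [FiniteDimensional ℝ E]

/-- Singular value decomposition of an endomorphism of a Euclidean space. -/
theorem exists_svd (hn : finrank ℝ E = n) (T : E →ₗ[ℝ] E) :
    ∃ u v : OrthonormalBasis (Fin n) ℝ E, ∀ i : Fin n, T (v i) = T.singularValues i • u i := by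
  set v := T.isSymmetric_adjoint_comp_self.eigenvectorBasis hn with hv
  have key : ∀ i j, inner ℝ (T (v i)) (T (v j)) = if i = j then T.singularValues i ^ 2 else 0 := by
    intro i j
    have h1 : inner ℝ (T (v i)) (T (v j)) = inner ℝ (v i) ((T.adjoint ∘ₗ T) (v j)) := by
      rw [LinearMap.comp_apply, LinearMap.adjoint_inner_right]
    rw [h1, hv, T.isSymmetric_adjoint_comp_self.apply_eigenvectorBasis hn j, inner_smul_right,
      OrthonormalBasis.inner_eq_ite, ← T.sq_singularValues_fin hn]
    by_cases h : i = j <;> simp [h]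
  set w : Fin n → E := fun i => (T.singularValues i)⁻¹ • T (v i)
  set S : Set (Fin n) := {i | T.singularValues i ≠ 0}
  have hw : Orthonormal ℝ (S.domRestrict w) := by
    rw [orthonormal_iff_ite]
    rintro ⟨i, hi⟩ ⟨j, hj⟩
    have hi' : T.singularValues i ≠ 0 := hi
    simp only [Set.domRestrict_apply, w, inner_smul_left, inner_smul_right, key, Subtype.mk.injEq]
    by_cases h : i = j
    · subst h
      simp
      field_simp
    · simp [h]
  -- Where the singular value vanishes, `u i` is an arbitrary completion of the basis; this is
  -- harmless because T (v i) = 0 there.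
  obtain ⟨u, hu⟩ := hw.exists_orthonormalBasis_extension_of_card_eq (by simp [hn])
  refine ⟨u, v, fun i => ?_⟩
  by_cases hi : T.singularValues i = 0
  · have := key i i
    rw [if_pos rfl, hi] at this
    simp only [ne_eq, OfNat.ofNat_ne_zero, not_false_eq_true, zero_pow, inner_self_eq_zero] at this
    rw [hi, this, zero_smul]
  · rw [hu i hi, smul_smul, mul_inv_cancel₀ hi, one_smul]

/-- Perturbing by a map of rank at most `k` moves the singular values by at most `k` places. -/
theorem singularValues_add_le (A F : E →ₗ[ℝ] E) {k : ℕ} (hF : finrank ℝ (LinearMap.range F) ≤ k)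
    (i : ℕ) : (A + F).singularValues (i + k) ≤ A.singularValues i := by
  obtain ⟨n, hn⟩ : ∃ n, finrank ℝ E = n := ⟨_, rfl⟩
  by_cases hik : n ≤ i + k
  · rw [LinearMap.singularValues_of_finrank_le _ (hn.trans_le hik)]
    exact A.singularValues_nonneg i
  push Not at hik
  obtain ⟨u, v, huv⟩ := exists_svd hn A
  obtain ⟨u', v', huv'⟩ := exists_svd hn (A + F)
  -- A shrinks vectors of P to at most σᵢ(A) times their norm, and A + F stretches vectors of Q by
  -- at least σᵢ₊ₖ(A + F). The dimensions of P, Q and ker F add up to at least (n - i) + (i + k + 1)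
  -- + (n - k) = 2n + 1, so the three share a nonzero vector, on which A and A + F agree.
  set P := Submodule.span ℝ (v '' ((Finset.Ici (⟨i, by omega⟩ : Fin n) : Finset (Fin n)) : Set _))
  set Q := Submodule.span ℝ (v' '' ((Finset.Iic (⟨i + k, hik⟩ : Fin n) : Finset (Fin n)) : Set _))
  have hP : finrank ℝ P = n - i := by rw [finrank_span_image]; simp
  have hQ : finrank ℝ Q = i + k + 1 := by rw [finrank_span_image]; simp
  have h1 := Submodule.finrank_sup_add_finrank_inf_eq P Q
  have h2 := Submodule.finrank_sup_add_finrank_inf_eq (P ⊓ Q) (LinearMap.ker F)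
  have h3 := Submodule.finrank_le (P ⊔ Q)
  have h4 := Submodule.finrank_le (P ⊓ Q ⊔ LinearMap.ker F)
  have h5 := F.finrank_range_add_finrank_ker
  have h6 : 0 < finrank ℝ (P ⊓ Q ⊓ LinearMap.ker F : Submodule ℝ E) := by omega
  obtain ⟨x, hx, hx0⟩ := Submodule.exists_mem_ne_zero_of_ne_bot
    (p := P ⊓ Q ⊓ LinearMap.ker F) (by rintro h; rw [h] at h6; simp at h6)
  obtain ⟨⟨hxP, hxQ⟩, hxF⟩ := hx
  have hxF' : F x = 0 := hxF
  have hA : ‖A x‖ ^ 2 ≤ A.singularValues i ^ 2 * ‖x‖ ^ 2 := by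
    rw [norm_sq_apply_of_svd huv, norm_sq_eq_sum_inner v, Finset.mul_sum]
    refine Finset.sum_le_sum fun j _ => ?_
    rw [mul_pow]
    by_cases hj : i ≤ j
    · gcongr
      · exact A.singularValues_nonneg _
      · exact A.singularValues_antitone hj
    · rw [inner_eq_zero_of_mem_span v hxP (by simpa [Fin.le_def] using hj)]
      simp
  have hB : (A + F).singularValues (i + k) ^ 2 * ‖x‖ ^ 2 ≤ ‖A x‖ ^ 2 := by
    have : A x = (A + F) x := by simp [hxF']
    rw [this, norm_sq_apply_of_svd huv', norm_sq_eq_sum_inner v', Finset.mul_sum]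
    refine Finset.sum_le_sum fun j _ => ?_
    rw [mul_pow]
    by_cases hj : (j : ℕ) ≤ i + k
    · gcongr
      · exact (A + F).singularValues_nonneg _
      · exact (A + F).singularValues_antitone hj
    · rw [inner_eq_zero_of_mem_span v' hxQ (by simpa [Fin.le_def] using hj)]
      simp
  have hpos : 0 < ‖x‖ ^ 2 := by positivity
  exact le_of_sq_le_sq (le_of_mul_le_mul_right (hB.trans hA) hpos) (A.singularValues_nonneg i)

/-- Courant–Fischer type bound: if a symmetric operator dominates a quadratic form that is
diagonal, with antitone diagonal `μ`, in an orthonormal basis, then its `i`-th eigenvalue is at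
least `μ i`. -/
theorem le_eigenvalues_of_diagonal_le (hn : finrank ℝ E = n) {S : E →ₗ[ℝ] E} (hS : S.IsSymmetric)
    (w : OrthonormalBasis (Fin n) ℝ E) {μ : Fin n → ℝ} (hμ : Antitone μ)
    (h : ∀ x, ∑ j, μ j * inner ℝ (w j) x ^ 2 ≤ inner ℝ (S x) x) (i : Fin n) :
    μ i ≤ hS.eigenvalues hn i := by
  set b := hS.eigenvectorBasis hn
  set P := Submodule.span ℝ (b '' ((Finset.Ici i : Finset (Fin n)) : Set _))
  set Q := Submodule.span ℝ (w '' ((Finset.Iic i : Finset (Fin n)) : Set _))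
  have hP : finrank ℝ P = n - i := by rw [finrank_span_image]; simp
  have hQ : finrank ℝ Q = i + 1 := by rw [finrank_span_image]; simp
  have h1 := Submodule.finrank_sup_add_finrank_inf_eq P Q
  have h3 := Submodule.finrank_le (P ⊔ Q)
  have h6 : 0 < finrank ℝ (P ⊓ Q : Submodule ℝ E) := by omega
  obtain ⟨x, hx, hx0⟩ := Submodule.exists_mem_ne_zero_of_ne_bot
    (p := P ⊓ Q) (by rintro h; rw [h] at h6; simp at h6)
  obtain ⟨hxP, hxQ⟩ := hx
  have hA : inner ℝ (S x) x ≤ hS.eigenvalues hn i * ‖x‖ ^ 2 := by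
    have h1 : inner ℝ (S x) x = ∑ j, hS.eigenvalues hn j * inner ℝ (b j) x ^ 2 := by
      rw [← b.sum_inner_mul_inner]
      refine Finset.sum_congr rfl fun j _ => ?_
      have : inner ℝ (S x) (b j) = hS.eigenvalues hn j * inner ℝ (b j) x := by
        rw [hS, hS.apply_eigenvectorBasis, inner_smul_right, real_inner_comm]
        rfl
      rw [this]
      ring
    rw [h1, norm_sq_eq_sum_inner b, Finset.mul_sum]
    refine Finset.sum_le_sum fun j _ => ?_
    by_cases hj : i ≤ j
    · gcongr
      exact hS.eigenvalues_antitone hn hj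
    · rw [inner_eq_zero_of_mem_span b hxP (by simpa using hj)]
      simp
  have hB : μ i * ‖x‖ ^ 2 ≤ inner ℝ (S x) x := by
    refine le_trans ?_ (h x)
    rw [norm_sq_eq_sum_inner w, Finset.mul_sum]
    refine Finset.sum_le_sum fun j _ => ?_
    by_cases hj : j ≤ i
    · gcongr
      exact hμ hj
    · rw [inner_eq_zero_of_mem_span w hxQ (by simpa using hj)]
      simp
  have hpos : 0 < ‖x‖ ^ 2 := by positivity
  exact le_of_mul_le_mul_right (hB.trans hA) hpos

end

/-! ### Self-adjoint dilation and Mirsky's inequality for rank-one perturbations. -/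

section

variable {E : Type*} [NormedAddCommGroup E] [InnerProductSpace ℝ E] {n : ℕ}

/-- The family `(uᵢ, vᵢ)/√2`, `(uᵢ, -vᵢ)/√2` attached to two orthonormal bases. -/
def dilationFamily (u v : OrthonormalBasis (Fin n) ℝ E) :
    Fin n ⊕ Fin n → WithLp 2 (E × E) :=
  Sum.elim (fun i => WithLp.toLp 2 ((√2)⁻¹ • u i, (√2)⁻¹ • v i))
    (fun i => WithLp.toLp 2 ((√2)⁻¹ • u i, -((√2)⁻¹ • v i)))

theorem inv_sqrt_two_mul_self : (√2 : ℝ)⁻¹ * (√2)⁻¹ = 1 / 2 := by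
  rw [← mul_inv, Real.mul_self_sqrt (by norm_num)]
  norm_num

theorem orthonormal_dilationFamily (u v : OrthonormalBasis (Fin n) ℝ E) :
    Orthonormal ℝ (dilationFamily u v) := by
  rw [orthonormal_iff_ite]
  rintro (i | i) (j | j) <;>
  · simp only [dilationFamily, Sum.elim_inl, Sum.elim_inr, real_inner_smul_left,
      real_inner_smul_right, WithLp.prod_inner_apply, u.inner_eq_ite, v.inner_eq_ite,
      inner_neg_left, inner_neg_right, ← mul_assoc, inv_sqrt_two_mul_self, Sum.inl.injEq,
      Sum.inr.injEq, reduceCtorEq, if_false]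
    by_cases h : i = j <;> simp [h] <;> norm_num

/-- The vectors (uᵢ, ±vᵢ)/√2 are eigenvectors of the dilation with eigenvalues ±σᵢ. Only this
diagonal form of its quadratic form is needed. -/
theorem sum_dilationFamily {u v : OrthonormalBasis (Fin n) ℝ E} {T : E →ₗ[ℝ] E}
    {σ : Fin n → ℝ} (h : ∀ i, T (v i) = σ i • u i) (x : WithLp 2 (E × E)) :
    ∑ k, Sum.elim σ (fun i => -σ i) k * inner ℝ (dilationFamily u v k) x ^ 2
      = 2 * inner ℝ (T x.snd) x.fst := by
  have h1 : inner ℝ (T x.snd) x.fst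
      = ∑ i, σ i * inner ℝ (v i) x.snd * inner ℝ (u i) x.fst := by
    conv_lhs => rw [← v.sum_repr' x.snd]
    rw [map_sum, sum_inner]
    refine Finset.sum_congr rfl fun i _ => ?_
    rw [map_smul, h, real_inner_smul_left, real_inner_smul_left]
    ring
  rw [h1, Fintype.sum_sum_type, ← Finset.sum_add_distrib, Finset.mul_sum]
  refine Finset.sum_congr rfl fun i _ => ?_
  simp only [dilationFamily, Sum.elim_inl, Sum.elim_inr, real_inner_smul_left,
    WithLp.prod_inner_apply, inner_neg_left]
  change σ i * ((√2)⁻¹ * inner ℝ (u i) x.fst + (√2)⁻¹ * inner ℝ (v i) x.snd) ^ 2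
    + -σ i * ((√2)⁻¹ * inner ℝ (u i) x.fst + -((√2)⁻¹ * inner ℝ (v i) x.snd)) ^ 2 = _
  linear_combination (4 * σ i * inner ℝ (u i) x.fst * inner ℝ (v i) x.snd) *
    inv_sqrt_two_mul_self

/-- The order in which the eigenvalues `σ₀ ≥ … ≥ σₙ₋₁ ≥ -σₙ₋₁ ≥ … ≥ -σ₀` are enumerated. -/
def dilationEquiv (n : ℕ) : Fin n ⊕ Fin n ≃ Fin (n + n) :=
  (Equiv.sumCongr (Equiv.refl _) Fin.revPerm).trans finSumFinEquiv

theorem dilationEquiv_symm_castAdd (i : Fin n) :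
    (dilationEquiv n).symm (Fin.castAdd n i) = Sum.inl i := by
  simp [dilationEquiv]

theorem dilationEquiv_symm_natAdd (i : Fin n) :
    (dilationEquiv n).symm (Fin.natAdd n i) = Sum.inr i.rev := by
  rw [Equiv.symm_apply_eq]
  simp [dilationEquiv]

theorem antitone_dilation {σ : Fin n → ℝ} (hσ : Antitone σ) (h0 : ∀ i, 0 ≤ σ i) :
    Antitone fun k => Sum.elim σ (fun i => -σ i) ((dilationEquiv n).symm k) := by
  intro k l
  refine Fin.addCases (fun i => ?_) (fun i => ?_) k <;>
  refine Fin.addCases (fun j => ?_) (fun j => ?_) l <;> intro hkl <;>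
  simp only [dilationEquiv_symm_castAdd, dilationEquiv_symm_natAdd, Sum.elim_inl, Sum.elim_inr]
  · exact hσ (show i ≤ j from hkl)
  · linarith [h0 i, h0 j.rev]
  · have h1 : n + (i : ℕ) ≤ j := hkl
    omega
  · have h1 : n + (i : ℕ) ≤ n + j := hkl
    have : i ≤ j := Fin.le_def.2 (by omega)
    linarith [hσ (Fin.rev_le_rev.2 this)]

variable [FiniteDimensional ℝ E]

/-- The self-adjoint dilation `(x, y) ↦ (T y, T* x)`. -/
def dilation (T : E →ₗ[ℝ] E) : WithLp 2 (E × E) →ₗ[ℝ] WithLp 2 (E × E) where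
  toFun x := WithLp.toLp 2 (T x.snd, T.adjoint x.fst)
  map_add' x y := by simp [← WithLp.toLp_add]
  map_smul' c x := by simp [← WithLp.toLp_smul]

theorem dilation_apply (T : E →ₗ[ℝ] E) (x : WithLp 2 (E × E)) :
    dilation T x = WithLp.toLp 2 (T x.snd, T.adjoint x.fst) := rfl

theorem inner_dilation (T : E →ₗ[ℝ] E) (x y : WithLp 2 (E × E)) :
    inner ℝ (dilation T x) y = inner ℝ (T x.snd) y.fst + inner ℝ x.fst (T y.snd) := by
  simp [dilation_apply, LinearMap.adjoint_inner_left]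

theorem trace_dilation (hn : finrank ℝ E = n) (T : E →ₗ[ℝ] E) :
    LinearMap.trace ℝ _ (dilation T) = 0 := by
  obtain ⟨b⟩ : Nonempty (OrthonormalBasis (Fin n) ℝ E) :=
    ⟨(stdOrthonormalBasis ℝ E).reindex (finCongr hn)⟩
  rw [LinearMap.trace_eq_sum_inner _ (b.prod b), Fintype.sum_sum_type]
  simp [dilation_apply]

theorem finrank_withLp_prod (hn : finrank ℝ E = n) : finrank ℝ (WithLp 2 (E × E)) = n + n := by
  rw [(WithLp.linearEquiv 2 ℝ (E × E)).finrank_eq, finrank_prod, hn]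

/-- Any symmetric S above the dilation of T as a quadratic form has its ordered eigenvalues above σ₀
≥ … ≥ -σ₀. The value -σᵢ sits at the mirror position n + `i.rev`. -/
theorem le_eigenvalues_of_dilation_le (hn : finrank ℝ E = n) (T : E →ₗ[ℝ] E)
    {S : WithLp 2 (E × E) →ₗ[ℝ] WithLp 2 (E × E)} (hS : S.IsSymmetric)
    (h : ∀ x, 2 * inner ℝ (T x.snd) x.fst ≤ inner ℝ (S x) x) (i : Fin n) :
    T.singularValues i ≤ hS.eigenvalues (finrank_withLp_prod hn) (Fin.castAdd n i) ∧
    -T.singularValues i ≤ hS.eigenvalues (finrank_withLp_prod hn) (Fin.natAdd n i.rev) := by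
  obtain ⟨u, v, huv⟩ := exists_svd hn T
  set σ : Fin n → ℝ := fun i => T.singularValues i
  have hw := (orthonormal_dilationFamily u v).comp _ (dilationEquiv n).symm.injective
  obtain ⟨w, hw'⟩ := Orthonormal.exists_orthonormalBasis_extension_of_card_eq
    (s := Set.univ) (v := dilationFamily u v ∘ (dilationEquiv n).symm)
    (by rw [finrank_withLp_prod hn, Fintype.card_fin]) (hw.comp _ Subtype.val_injective)
  have hμ := antitone_dilation (σ := σ) (fun i j hij => T.singularValues_antitone hij)
    (fun i => T.singularValues_nonneg i)
  have key := le_eigenvalues_of_diagonal_le (finrank_withLp_prod hn) hS w hμ (fun x => by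
    refine le_trans (le_of_eq ?_) (h x)
    rw [← sum_dilationFamily huv x, ← (dilationEquiv n).symm.sum_comp]
    refine Finset.sum_congr rfl fun j _ => ?_
    rw [hw' j trivial]
    rfl)
  constructor
  · simpa [dilationEquiv_symm_castAdd] using key (Fin.castAdd n i)
  · have := key (Fin.natAdd n i.rev)
    rwa [dilationEquiv_symm_natAdd, Fin.rev_rev] at this

/-- Mirsky's inequality for a perturbation of rank one. -/
theorem sum_abs_singularValues_sub_le (hn : finrank ℝ E = n) (A F : E →ₗ[ℝ] E) {u v : E}
    (hu : ‖u‖ = 1) (hv : ‖v‖ = 1) {e : ℝ} (he : 0 ≤ e)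
    (hF : ∀ x, F x = (e * inner ℝ v x) • u) :
    ∑ i : Fin n, |A.singularValues i - (A + F).singularValues i| ≤ e := by
  set w : WithLp 2 (E × E) := WithLp.toLp 2 (u, v) with hw
  set R : WithLp 2 (E × E) →ₗ[ℝ] WithLp 2 (E × E) :=
    (InnerProductSpace.rankOne ℝ w w).toLinearMap with hR
  have hRx : ∀ x, R x = inner ℝ w x • w := fun x => by simp [hR]
  -- S dominates the dilation of A since e ≥ 0, and that of A + F since (e/2)(a + b)² - 2e·ab =
  -- (e/2)(a - b)². As ‖w‖² = 2 and dilations have trace zero, S has trace e.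
  set S := dilation A + (e / 2) • R with hSdef
  have hinner : ∀ x y, inner ℝ (S x) y = inner ℝ (A x.snd) y.fst + inner ℝ x.fst (A y.snd)
      + e / 2 * (inner ℝ w x * inner ℝ w y) := by
    intro x y
    rw [hSdef, LinearMap.add_apply, inner_add_left, inner_dilation, LinearMap.smul_apply, hRx,
      real_inner_smul_left, real_inner_smul_left]
  have hS : S.IsSymmetric := by
    intro x y
    rw [real_inner_comm (S y) x, hinner, hinner, real_inner_comm (A x.snd),
      real_inner_comm (A y.snd)]
    ring
  have hwx : ∀ x : WithLp 2 (E × E), inner ℝ w x = inner ℝ u x.fst + inner ℝ v x.snd := by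
    intro x
    simp [hw]
  have hA := le_eigenvalues_of_dilation_le hn A hS (fun x => by
    rw [hinner, real_inner_comm (A x.snd) x.fst]
    nlinarith [mul_self_nonneg (inner ℝ w x)])
  have hB := le_eigenvalues_of_dilation_le hn (A + F) hS (fun x => by
    rw [hinner, real_inner_comm (A x.snd) x.fst, LinearMap.add_apply, inner_add_left, hF,
      real_inner_smul_left, hwx]
    nlinarith [mul_nonneg he (mul_self_nonneg (inner ℝ u x.fst - inner ℝ v x.snd))])
  have htr : ∑ k, hS.eigenvalues (finrank_withLp_prod hn) k = e := by
    have h1 := hS.trace_eq_sum_eigenvalues (finrank_withLp_prod hn)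
    have h2 : LinearMap.trace ℝ _ R = 2 := by
      rw [hR, InnerProductSpace.trace_rankOne]
      simp only [hw, real_inner_self_eq_norm_sq, WithLp.prod_norm_sq_eq_of_L2]
      simp [hu, hv]
      norm_num
    have h3 : LinearMap.trace ℝ _ S = e := by
      rw [hSdef, map_add, trace_dilation hn, map_smul, h2, smul_eq_mul]
      ring
    exact h1.symm.trans h3
  -- Each eigenvalue is paired with its mirror image. The first is at least σᵢ(A) and σᵢ(A + F), the
  -- second at least their negatives, so each pair sums to at least the absolute difference.
  rw [Fin.sum_univ_add,
    ← Equiv.sum_comp Fin.revPerm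
      (fun i => hS.eigenvalues (finrank_withLp_prod hn) (Fin.natAdd n i)),
    ← Finset.sum_add_distrib] at htr
  rw [← htr]
  refine Finset.sum_le_sum fun i _ => ?_
  have h1 := hA i
  have h2 := hB i
  rw [Fin.revPerm_apply, abs_le]
  constructor <;> linarith

end

/-! ### Concavity, interlacing and the concave Mirsky inequality. -/

section

/-- Both m and l + d are convex combinations of l and m + d, with the two weights exchanged; adding
the two concavity inequalities gives the claim. -/
theorem rpow_add_add_rpow_le {p : ℝ} (hp : 0 ≤ p) (hp1 : p ≤ 1) {l m d : ℝ} (hl : 0 ≤ l)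
    (hlm : l ≤ m) (hd : 0 ≤ d) : (m + d) ^ p + l ^ p ≤ (l + d) ^ p + m ^ p := by
  rcases eq_or_lt_of_le (show l ≤ m + d by linarith) with h | h
  · have h1 : d = 0 := by linarith
    have h2 : l = m := by linarith
    subst h1 h2
    simp
  have hD : 0 < m + d - l := by linarith
  have hc := (Real.concaveOn_rpow hp hp1).2
  have h1 := hc (x := l) hl (y := m + d) (show (0 : ℝ) ≤ m + d by linarith)
    (a := d / (m + d - l)) (b := (m - l) / (m + d - l)) (by positivity)
    (div_nonneg (by linarith) hD.le) (by field_simp; ring)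
  have h2 := hc (x := l) hl (y := m + d) (show (0 : ℝ) ≤ m + d by linarith)
    (a := (m - l) / (m + d - l)) (b := d / (m + d - l))
    (div_nonneg (by linarith) hD.le) (by positivity) (by field_simp; ring)
  simp only [smul_eq_mul] at h1 h2
  rw [show d / (m + d - l) * l + (m - l) / (m + d - l) * (m + d) = m by field_simp; ring] at h1
  rw [show (m - l) / (m + d - l) * l + d / (m + d - l) * (m + d) = l + d by
    field_simp; ring] at h2
  have h3 : d / (m + d - l) + (m - l) / (m + d - l) = 1 := by field_simp; ring
  have h4 : d / (m + d - l) = 1 - (m - l) / (m + d - l) := by linarith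
  rw [h4] at h1 h2
  linarith

/-- The gaps between two interlacing sequences are disjoint subintervals. -/
theorem sum_abs_sub_le_max_of_interlacing (n : ℕ) (a b : ℕ → ℝ) (ha : Antitone a)
    (hb : Antitone b) (ha0 : ∀ i, 0 ≤ a i) (hb0 : ∀ i, 0 ≤ b i) (hab : ∀ i, a (i + 1) ≤ b i)
    (hba : ∀ i, b (i + 1) ≤ a i) :
    ∑ i ∈ Finset.range n, |a i - b i| ≤ max (a 0) (b 0) := by
  induction n generalizing a b with
  | zero => simpa using Or.inl (ha0 0)
  | succ n ih =>
    have h := ih (fun i => a (i + 1)) (fun i => b (i + 1)) (fun i j hij => ha (by omega))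
      (fun i j hij => hb (by omega)) (fun i => ha0 _) (fun i => hb0 _) (fun i => hab _)
      (fun i => hba _)
    rw [Finset.sum_range_succ']
    have h1 : max (a (0 + 1)) (b (0 + 1)) ≤ min (a 0) (b 0) :=
      le_min (max_le (ha (by omega)) (hba 0)) (max_le (hab 0) (hb (by omega)))
    linarith [max_sub_min_eq_abs' (a 0) (b 0)]

/-- By concavity, sliding the disjoint gaps down towards 0 only increases the total increment of x ^
p. The induction peels off the top gap: the remaining gaps have total length at most min (a 0) (b
0), so `rpow_add_add_rpow_le` applies with d the top gap. -/
theorem sum_abs_rpow_sub_le_of_interlacing {p : ℝ} (hp : 0 < p) (hp1 : p ≤ 1) (n : ℕ)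
    (a b : ℕ → ℝ) (ha : Antitone a) (hb : Antitone b) (ha0 : ∀ i, 0 ≤ a i) (hb0 : ∀ i, 0 ≤ b i)
    (hab : ∀ i, a (i + 1) ≤ b i) (hba : ∀ i, b (i + 1) ≤ a i) :
    ∑ i ∈ Finset.range n, |a i ^ p - b i ^ p| ≤ (∑ i ∈ Finset.range n, |a i - b i|) ^ p := by
  induction n generalizing a b with
  | zero => simp [Real.zero_rpow hp.ne']
  | succ n ih =>
    have h := ih (fun i => a (i + 1)) (fun i => b (i + 1)) (fun i j hij => ha (by omega))
      (fun i j hij => hb (by omega)) (fun i => ha0 _) (fun i => hb0 _) (fun i => hab _)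
      (fun i => hba _)
    have h' := sum_abs_sub_le_max_of_interlacing n (fun i => a (i + 1)) (fun i => b (i + 1))
      (fun i j hij => ha (by omega))
      (fun i j hij => hb (by omega)) (fun i => ha0 _) (fun i => hb0 _) (fun i => hab _)
      (fun i => hba _)
    rw [Finset.sum_range_succ', Finset.sum_range_succ']
    have h1 : max (a (0 + 1)) (b (0 + 1)) ≤ min (a 0) (b 0) :=
      le_min (max_le (ha (by omega)) (hba 0)) (max_le (hab 0) (hb (by omega)))
    have h2 := rpow_add_add_rpow_le hp.le hp1
      (Finset.sum_nonneg fun i (_ : i ∈ Finset.range n) => abs_nonneg (a (i + 1) - b (i + 1)))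
      (h'.trans h1) (abs_nonneg (a 0 - b 0))
    have h3 : min (a 0) (b 0) + |a 0 - b 0| = max (a 0) (b 0) := by
      linarith [max_sub_min_eq_abs' (a 0) (b 0)]
    rw [h3] at h2
    have h4 : |a 0 ^ p - b 0 ^ p| = max (a 0) (b 0) ^ p - min (a 0) (b 0) ^ p := by
      rcases le_total (a 0) (b 0) with hle | hle
      · rw [max_eq_right hle, min_eq_left hle, abs_sub_comm, abs_of_nonneg]
        linarith [Real.rpow_le_rpow (ha0 0) hle hp.le]
      · rw [max_eq_left hle, min_eq_right hle, abs_of_nonneg]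
        linarith [Real.rpow_le_rpow (hb0 0) hle hp.le]
    rw [h4]
    linarith

variable {E : Type*} [NormedAddCommGroup E] [InnerProductSpace ℝ E] {n : ℕ}

theorem finrank_range_le_one {F : E →ₗ[ℝ] E} {u v : E} {e : ℝ}
    (hF : ∀ x, F x = (e * inner ℝ v x) • u) : finrank ℝ (LinearMap.range F) ≤ 1 := by
  refine (Submodule.finrank_mono (t := Submodule.span ℝ {u}) ?_).trans
    ((finrank_span_le_card _).trans (by simp))
  rintro _ ⟨x, rfl⟩
  rw [hF]
  exact Submodule.smul_mem _ _ (Submodule.mem_span_singleton_self u)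

variable [FiniteDimensional ℝ E]

theorem sum_abs_rpow_singularValues_sub_le_of_rank_one {p : ℝ} (hp : 0 < p) (hp1 : p ≤ 1)
    (hn : finrank ℝ E = n) (A F : E →ₗ[ℝ] E) {u v : E}
    (hu : ‖u‖ = 1) (hv : ‖v‖ = 1) {e : ℝ} (he : 0 ≤ e)
    (hF : ∀ x, F x = (e * inner ℝ v x) • u) :
    ∑ i : Fin n, |A.singularValues i ^ p - (A + F).singularValues i ^ p| ≤ e ^ p := by
  have h1 := sum_abs_singularValues_sub_le hn A F hu hv he hF
  have h2 := sum_abs_rpow_sub_le_of_interlacing hp hp1 n A.singularValues (A + F).singularValues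
    A.singularValues_antitone (A + F).singularValues_antitone A.singularValues_nonneg
    (A + F).singularValues_nonneg
    (fun i => by
      have := singularValues_add_le (A + F) (-F) (k := 1)
        (by rw [LinearMap.range_neg]; exact finrank_range_le_one hF) i
      rwa [add_neg_cancel_right] at this)
    (fun i => singularValues_add_le A F (finrank_range_le_one hF) i)
  rw [Finset.sum_range, Finset.sum_range] at h2
  exact h2.trans (Real.rpow_le_rpow (Finset.sum_nonneg fun i _ => abs_nonneg _) h1 hp.le)

/-- The concave Mirsky inequality for the function `x ^ p`, `0 < p ≤ 1`. -/
theorem sum_abs_rpow_singularValues_sub_le {p : ℝ} (hp : 0 < p) (hp1 : p ≤ 1)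
    (hn : finrank ℝ E = n) (A F : E →ₗ[ℝ] E) :
    ∑ i : Fin n, |A.singularValues i ^ p - (A + F).singularValues i ^ p|
      ≤ ∑ i : Fin n, F.singularValues i ^ p := by
  classical
  obtain ⟨u, v, huv⟩ := exists_svd hn F
  set R : Fin n → E →ₗ[ℝ] E := fun i =>
    F.singularValues i • (InnerProductSpace.rankOne ℝ (u i) (v i)).toLinearMap with hR
  have hRx : ∀ i x, R i x = (F.singularValues i * inner ℝ (v i) x) • u i := by
    intro i x
    simp [hR, smul_smul]
  have hF : F = ∑ i, R i := by
    refine v.toBasis.ext fun j => ?_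
    simp [hRx, v.inner_eq_ite, huv]
  have key : ∀ s : Finset (Fin n),
      ∑ i : Fin n, |A.singularValues i ^ p - (A + ∑ j ∈ s, R j).singularValues i ^ p|
        ≤ ∑ j ∈ s, F.singularValues j ^ p := by
    intro s
    induction s using Finset.induction_on with
    | empty => simp
    | insert j s hj ih =>
      have h1 := sum_abs_rpow_singularValues_sub_le_of_rank_one hp hp1 hn
        (A + ∑ j ∈ s, R j) (R j) (u.norm_eq_one j) (v.norm_eq_one j)
        (F.singularValues_nonneg j) (hRx j)
      rw [Finset.sum_insert hj, Finset.sum_insert hj, add_comm (R j), ← add_assoc]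
      refine le_trans ?_ ((add_le_add ih h1).trans_eq (add_comm _ _))
      rw [← Finset.sum_add_distrib]
      exact Finset.sum_le_sum fun i _ => abs_sub_le _ _ _
  have := key Finset.univ
  rwa [← hF] at this

end

/-! ### Block decomposition of a decreasing vector. -/

section

/-- Near-preservation of norms on a plane makes orthogonal vectors of the plane nearly orthogonal
after mapping. -/
theorem neg_inner_map_le {H F : Type*} [NormedAddCommGroup H] [InnerProductSpace ℝ H]
    [NormedAddCommGroup F] [InnerProductSpace ℝ F] (G : H →ₗ[ℝ] F) {α β : ℝ} (hα : 0 ≤ α)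
    {c d : H} (hcd : inner ℝ c d = 0)
    (hG : ∀ x y : ℝ, α * ‖x • c + y • d‖ ≤ ‖G (x • c + y • d)‖ ∧
      ‖G (x • c + y • d)‖ ≤ β * ‖x • c + y • d‖) :
    -inner ℝ (G c) (G d) ≤ (β ^ 2 - α ^ 2) / 2 * (‖c‖ * ‖d‖) := by
  by_cases hc : c = 0
  · simp [hc]
  by_cases hd : d = 0
  · simp [hd]
  have hc' : 0 < ‖c‖ := norm_pos_iff.2 hc
  have hd' : 0 < ‖d‖ := norm_pos_iff.2 hd
  have hsq : ∀ x y : ℝ, ‖x • c + y • d‖ ^ 2 = x ^ 2 * ‖c‖ ^ 2 + y ^ 2 * ‖d‖ ^ 2 := by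
    intro x y
    rw [norm_add_sq_real, real_inner_smul_left, real_inner_smul_right, hcd, norm_smul, norm_smul,
      mul_pow, mul_pow, Real.norm_eq_abs, Real.norm_eq_abs, sq_abs, sq_abs]
    ring
  have hsq' : ∀ x y : ℝ, ‖G (x • c + y • d)‖ ^ 2
      = x ^ 2 * ‖G c‖ ^ 2 + 2 * (x * y * inner ℝ (G c) (G d)) + y ^ 2 * ‖G d‖ ^ 2 := by
    intro x y
    rw [map_add, map_smul, map_smul, norm_add_sq_real, real_inner_smul_left,
      real_inner_smul_right, norm_smul, norm_smul,
      mul_pow, mul_pow, Real.norm_eq_abs, Real.norm_eq_abs, sq_abs, sq_abs]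
    ring
  -- The vectors ‖d‖c ± ‖c‖d have equal norms by orthogonality, and polarisation of their images
  -- isolates the inner product.
  have h1 := pow_le_pow_left₀ (by positivity) (hG ‖d‖ ‖c‖).1 2
  have h2 := pow_le_pow_left₀ (norm_nonneg _) (hG ‖d‖ (-‖c‖)).2 2
  rw [mul_pow, hsq, hsq'] at h1 h2
  have h3 : (‖c‖ * ‖d‖) * (-inner ℝ (G c) (G d))
      ≤ (‖c‖ * ‖d‖) * ((β ^ 2 - α ^ 2) / 2 * (‖c‖ * ‖d‖)) := by
    nlinarith
  exact le_of_mul_le_mul_left h3 (by positivity)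

/-- The point (x, y) lies in the disc with centre (S/2, S/2) and radius S/√2. -/
theorem le_of_sq_add_sq_le {x y S : ℝ} (hS : 0 ≤ S) (h : x ^ 2 + y ^ 2 ≤ S * (x + y)) :
    x ≤ (1 + √2) / 2 * S := by
  have h2 : (√2 : ℝ) ^ 2 = 2 := Real.sq_sqrt (by norm_num)
  have h1 : (x - S / 2) ^ 2 ≤ (√2 / 2 * S) ^ 2 := by
    nlinarith [sq_nonneg (y - S / 2)]
  have := abs_le_of_sq_le_sq h1 (by positivity)
  linarith [le_abs_self (x - S / 2)]

/-- The number of the block containing `i`: the first block has length `s`, all others `t`. -/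
def blockIndex (s t i : ℕ) : ℕ := if i < s then 0 else (i - s) / t + 1

theorem blockIndex_eq_zero {s t i : ℕ} : blockIndex s t i = 0 ↔ i < s := by
  unfold blockIndex
  split_ifs with h <;> simp [h]

theorem blockIndex_eq_succ {s t i k : ℕ} (ht : 0 < t) :
    blockIndex s t i = k + 1 ↔ s + k * t ≤ i ∧ i < s + k * t + t := by
  unfold blockIndex
  split_ifs with h
  · constructor
    · intro h'
      exact h'.elim
    · intro h'
      have := Nat.zero_le (k * t)
      omega
  · rw [Nat.add_right_cancel_iff, Nat.div_eq_iff ht]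
    have : t * k = k * t := mul_comm _ _
    omega

/-- A crude count: after blocks 0 and 1 are split off, the remaining blocks are indexed by
`Finset.range N`. -/
theorem blockIndex_lt {s t i N : ℕ} (hi : i < N) : blockIndex s t i < N + 2 := by
  unfold blockIndex
  split_ifs with h
  · omega
  · have := Nat.div_le_self (i - s) t
    omega

variable {N : ℕ}

/-- The part of a vector lying in the `k`-th block. -/
def blockPart (s t : ℕ) (a : EuclideanSpace ℝ (Fin N)) (k : ℕ) : EuclideanSpace ℝ (Fin N) :=
  WithLp.toLp 2 fun i => if blockIndex s t i = k then a i else 0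

theorem blockPart_apply (s t : ℕ) (a : EuclideanSpace ℝ (Fin N)) (k : ℕ) (i : Fin N) :
    blockPart s t a k i = if blockIndex s t i = k then a i else 0 := rfl

/-- The indices in the `k`-th block. -/
def blockSet (N s t k : ℕ) : Finset (Fin N) :=
  Finset.univ.filter fun i => blockIndex s t i = k

theorem sum_blockPart (s t : ℕ) (a : EuclideanSpace ℝ (Fin N)) :
    ∑ k ∈ Finset.range (N + 2), blockPart s t a k = a := by
  ext i
  rw [WithLp.ofLp_sum, Finset.sum_apply]
  simp only [blockPart_apply]
  rw [Finset.sum_ite_eq, if_pos (Finset.mem_range.2 (blockIndex_lt i.2))]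

theorem inner_blockPart (s t : ℕ) (a : EuclideanSpace ℝ (Fin N)) {k l : ℕ} (hkl : k ≠ l) :
    inner ℝ (blockPart s t a k) (blockPart s t a l) = 0 := by
  rw [PiLp.inner_apply]
  refine Finset.sum_eq_zero fun i _ => ?_
  rw [blockPart_apply, blockPart_apply]
  split_ifs with h1 h2
  · exact absurd (h1.symm.trans h2) hkl
  all_goals simp

theorem norm_sq_blockPart (s t : ℕ) (a : EuclideanSpace ℝ (Fin N)) (k : ℕ) :
    ‖blockPart s t a k‖ ^ 2 = ∑ i ∈ blockSet N s t k, a i ^ 2 := by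
  rw [EuclideanSpace.norm_sq_eq, blockSet, Finset.sum_filter]
  refine Finset.sum_congr rfl fun i _ => ?_
  rw [blockPart_apply]
  split_ifs <;> simp

theorem card_blockSet_zero_le (N s t : ℕ) : (blockSet N s t 0).card ≤ s := by
  have := Finset.card_le_card_of_injOn (s := blockSet N s t 0) (t := Finset.range s) Fin.val
    (fun i hi => by simpa [blockSet, blockIndex_eq_zero] using hi) (Fin.val_injective.injOn)
  simpa using this

theorem card_blockSet_succ_le (N s k : ℕ) {t : ℕ} (ht : 0 < t) :
    (blockSet N s t (k + 1)).card ≤ t := by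
  have := Finset.card_le_card_of_injOn (s := blockSet N s t (k + 1))
    (t := Finset.Ico (s + k * t) (s + k * t + t)) Fin.val
    (fun i hi => by simpa [blockSet, blockIndex_eq_succ ht] using hi) (Fin.val_injective.injOn)
  simpa using this

theorem card_blockSet_le {N s t : ℕ} (hst : s ≤ t) (ht : 0 < t) (k : ℕ) :
    (blockSet N s t k).card ≤ t := by
  cases k with
  | zero => exact (card_blockSet_zero_le N s t).trans hst
  | succ k => exact card_blockSet_succ_le N s k ht

/-- Only the last nonempty block can be short: if block k + 2 has an element, block k + 1 is full.
-/
theorem le_card_blockSet {s t k : ℕ} (ht : 0 < t) {i : Fin N}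
    (hi : i ∈ blockSet N s t (k + 2)) : t ≤ (blockSet N s t (k + 1)).card := by
  have h1 : s + (k + 1) * t ≤ i ∧ (i : ℕ) < s + (k + 1) * t + t := by
    simpa [blockSet, blockIndex_eq_succ (k := k + 1) ht] using hi
  have h2 : (k + 1) * t = k * t + t := by ring
  have := Finset.card_le_card_of_injOn (s := (Finset.univ : Finset (Fin t)))
    (t := blockSet N s t (k + 1)) (fun j => ⟨s + k * t + j, by omega⟩)
    (fun j _ => by
      simp only [blockSet, Finset.coe_filter, Finset.mem_univ, true_and, Set.mem_ofPred_eq,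
        blockIndex_eq_succ ht]
      omega)
    (fun j _ l _ h => by
      simp only [Fin.mk.injEq] at h
      exact Fin.ext (by omega))
  simpa using this

theorem rpow_mul_le_sum_blockSet {p : ℝ} (hp : 0 < p) {s t k : ℕ} (ht : 0 < t)
    {a : Fin N → ℝ} (ha : Antitone a) (ha0 : ∀ i, 0 ≤ a i) {i : Fin N}
    (hi : i ∈ blockSet N s t (k + 2)) : t * a i ^ p ≤ ∑ j ∈ blockSet N s t (k + 1), a j ^ p := by
  have h1 : ∀ j ∈ blockSet N s t (k + 1), a i ^ p ≤ a j ^ p := by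
    intro j hj
    refine Real.rpow_le_rpow (ha0 i) (ha ?_) hp.le
    simp only [blockSet, Finset.mem_filter, Finset.mem_univ, true_and,
      blockIndex_eq_succ ht] at hi hj
    have h2 : (k + 1) * t = k * t + t := by ring
    exact Fin.le_def.2 (by omega)
  have h2 := Finset.card_nsmul_le_sum _ _ _ h1
  rw [nsmul_eq_mul] at h2
  refine le_trans ?_ h2
  gcongr
  · exact Real.rpow_nonneg (ha0 i) _
  · exact le_card_blockSet ht hi

/-- Each entry has p-th power at most the mean of the p-th powers over the preceding full block, and
there are at most t entries. -/
theorem norm_blockPart_le {p : ℝ} (hp : 0 < p) {s t : ℕ} (hst : s ≤ t) (ht : 0 < t)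
    {a : EuclideanSpace ℝ (Fin N)} (ha : Antitone a) (ha0 : ∀ i, 0 ≤ a i) (k : ℕ) :
    ‖blockPart s t a (k + 2)‖
      ≤ (∑ j ∈ blockSet N s t (k + 1), a j ^ p) ^ (1 / p) * (t : ℝ) ^ (1 / 2 - 1 / p) := by
  set x := ∑ j ∈ blockSet N s t (k + 1), a j ^ p
  have hx : 0 ≤ x := Finset.sum_nonneg fun j _ => Real.rpow_nonneg (ha0 j) _
  have ht' : (0 : ℝ) < t := by exact_mod_cast ht
  have h1 : ∀ i ∈ blockSet N s t (k + 2), a i ^ 2 ≤ ((x / t) ^ (1 / p)) ^ 2 := by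
    intro i hi
    have h := rpow_mul_le_sum_blockSet hp ht ha ha0 hi
    refine pow_le_pow_left₀ (ha0 i) ?_ 2
    have h' : a i ^ p ≤ x / t := by rw [le_div_iff₀ ht']; linarith
    calc a i = (a i ^ p) ^ (1 / p) := by
          rw [← Real.rpow_mul (ha0 i), mul_one_div_cancel hp.ne', Real.rpow_one]
      _ ≤ _ := Real.rpow_le_rpow (Real.rpow_nonneg (ha0 i) _) h' (by positivity)
  have h2 := Finset.sum_le_card_nsmul _ _ _ h1
  rw [← norm_sq_blockPart, nsmul_eq_mul] at h2
  have h3 : ‖blockPart s t a (k + 2)‖ ^ 2 ≤ t * ((x / t) ^ (1 / p)) ^ 2 := by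
    refine h2.trans ?_
    gcongr
    exact card_blockSet_le hst ht _
  have h4 : t * ((x / t) ^ (1 / p)) ^ 2 = (x ^ (1 / p) * (t : ℝ) ^ (1 / 2 - 1 / p)) ^ 2 := by
    rw [Real.div_rpow hx ht'.le, Real.rpow_sub ht', ← Real.sqrt_eq_rpow]
    have := Real.sq_sqrt ht'.le
    field_simp
    rw [this]
    ring
  rw [h4] at h3
  exact le_of_sq_le_sq h3 (by positivity)

theorem sum_rpow_le_rpow_sum {ι : Type*} (s : Finset ι) (f : ι → ℝ) (hf : ∀ i ∈ s, 0 ≤ f i)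
    {q : ℝ} (hq : 1 ≤ q) : ∑ i ∈ s, f i ^ q ≤ (∑ i ∈ s, f i) ^ q := by
  classical
  induction s using Finset.induction_on with
  | empty => simp [Real.zero_rpow (by linarith : q ≠ 0)]
  | insert i s hi ih =>
    rw [Finset.sum_insert hi, Finset.sum_insert hi]
    have h := ih fun j hj => hf j (Finset.mem_insert_of_mem hj)
    have h1 := Real.add_rpow_le_rpow_add (hf i (Finset.mem_insert_self i s))
      (Finset.sum_nonneg fun j hj => hf j (Finset.mem_insert_of_mem hj)) hq
    linarith

theorem sum_blockSet_le (s t : ℕ) (f : Fin N → ℝ) (hf : ∀ i, 0 ≤ f i) :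
    ∑ k ∈ Finset.range N, ∑ i ∈ blockSet N s t (k + 1), f i
      ≤ ∑ i : Fin N, if s ≤ (i : ℕ) then f i else 0 := by
  simp only [blockSet, Finset.sum_filter]
  rw [Finset.sum_comm]
  refine Finset.sum_le_sum fun i _ => ?_
  split_ifs with h
  · by_cases h1 : ∃ k, blockIndex s t i = k + 1
    · obtain ⟨k, hk⟩ := h1
      simp only [hk, Nat.add_right_cancel_iff]
      rw [Finset.sum_ite_eq]
      split_ifs
      · exact le_rfl
      · exact hf i
    · push Not at h1
      rw [Finset.sum_eq_zero fun k _ => if_neg (h1 k)]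
      exact hf i
  · rw [Finset.sum_eq_zero fun k _ => if_neg ?_]
    have := (blockIndex_eq_zero (s := s) (t := t) (i := i)).2 (by omega)
    omega

/-- Sums the blockwise bounds, using that x ^ (1/p) is superadditive since 1/p ≥ 1. The shift by one
block brings in block 1, so the ℓ_p mass is that of the entire tail beyond s. -/
theorem sum_norm_blockPart_le {p : ℝ} (hp : 0 < p) (hp1 : p ≤ 1) {s t : ℕ} (hst : s ≤ t)
    (ht : 0 < t) {a : EuclideanSpace ℝ (Fin N)} (ha : Antitone a) (ha0 : ∀ i, 0 ≤ a i) :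
    ∑ k ∈ Finset.range N, ‖blockPart s t a (k + 2)‖
      ≤ (∑ i : Fin N, if s ≤ (i : ℕ) then a i ^ p else 0) ^ (1 / p)
        * (t : ℝ) ^ (1 / 2 - 1 / p) := by
  refine (Finset.sum_le_sum fun k _ => norm_blockPart_le hp hst ht ha ha0 k).trans ?_
  rw [← Finset.sum_mul]
  gcongr
  have h0 : ∀ i, 0 ≤ a i ^ p := fun i => Real.rpow_nonneg (ha0 i) _
  refine (sum_rpow_le_rpow_sum _ _ (fun k _ => Finset.sum_nonneg fun j _ => h0 j)
    (by rw [le_div_iff₀ hp]; linarith)).trans ?_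
  exact Real.rpow_le_rpow (Finset.sum_nonneg fun k _ => Finset.sum_nonneg fun j _ => h0 j)
    (sum_blockSet_le s t _ h0) (by positivity)

/-- The map `G` changes norms of vectors with at most `k` nonzero entries by factors between
`α` and `β`. -/
def IsRestrictedIsometry {F : Type*} [NormedAddCommGroup F] [InnerProductSpace ℝ F]
    (G : EuclideanSpace ℝ (Fin N) →ₗ[ℝ] F) (α β : ℝ) (k : ℕ) : Prop :=
  ∀ S : Finset (Fin N), S.card ≤ k → ∀ z : EuclideanSpace ℝ (Fin N), (∀ i, i ∉ S → z i = 0) →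
    α * ‖z‖ ≤ ‖G z‖ ∧ ‖G z‖ ≤ β * ‖z‖

/-! ### Kernel vectors of a restricted isometry. -/

section Kernel

variable {F : Type*} [NormedAddCommGroup F] [InnerProductSpace ℝ F]
  {G : EuclideanSpace ℝ (Fin N) →ₗ[ℝ] F} {α β : ℝ} {s t : ℕ}

theorem IsRestrictedIsometry.blockPart_pair (hG : IsRestrictedIsometry G α β (2 * t))
    (hst : s ≤ t) (ht : 0 < t) (a : EuclideanSpace ℝ (Fin N)) (k l : ℕ) (x y : ℝ) :
    α * ‖x • blockPart s t a k + y • blockPart s t a l‖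
        ≤ ‖G (x • blockPart s t a k + y • blockPart s t a l)‖ ∧
      ‖G (x • blockPart s t a k + y • blockPart s t a l)‖
        ≤ β * ‖x • blockPart s t a k + y • blockPart s t a l‖ := by
  classical
  refine hG (blockSet N s t k ∪ blockSet N s t l) ?_ _ fun i hi => ?_
  · have := Finset.card_union_le (blockSet N s t k) (blockSet N s t l)
    have h1 := card_blockSet_le (N := N) hst ht k
    have h2 := card_blockSet_le (N := N) hst ht l
    omega
  · simp only [blockSet, Finset.mem_union, Finset.mem_filter, Finset.mem_univ, true_and,
      not_or] at hi
    simp [blockPart_apply, hi.1, hi.2]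

/-- Since G a = 0, the image of blocks 0 and 1 is minus the image of all the others. Expanding ‖G (c
0 + c 1)‖² against that sum leaves only inner products of distinct blocks, each small by
`neg_inner_map_le`; two blocks have at most 2t entries. -/
theorem IsRestrictedIsometry.norm_blockPart_sq_add_le (hG : IsRestrictedIsometry G α β (2 * t))
    (hα : 0 < α) (hst : s ≤ t) (ht : 0 < t) {a : EuclideanSpace ℝ (Fin N)} (hGa : G a = 0) :
    ‖blockPart s t a 0‖ ^ 2 + ‖blockPart s t a 1‖ ^ 2
      ≤ (β ^ 2 / α ^ 2 - 1) / 2 * (∑ k ∈ Finset.range N, ‖blockPart s t a (k + 2)‖)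
        * (‖blockPart s t a 0‖ + ‖blockPart s t a 1‖) := by
  set c := blockPart s t a with hc
  have hsum : G (c 0 + c 1) = -∑ k ∈ Finset.range N, G (c (k + 2)) := by
    have h1 := sum_blockPart s t a
    rw [Finset.sum_range_succ', Finset.sum_range_succ'] at h1
    have h2 := congrArg G h1
    rw [hGa, map_add, map_add, map_sum] at h2
    rw [map_add, eq_neg_iff_add_eq_zero, ← h2]
    simp only [zero_add]
    abel
  have hpair : ∀ k l, k ≠ l → -inner ℝ (G (c k)) (G (c l))
      ≤ (β ^ 2 - α ^ 2) / 2 * (‖c k‖ * ‖c l‖) := fun k l hkl =>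
    neg_inner_map_le G hα.le (inner_blockPart s t a hkl) (hG.blockPart_pair hst ht a k l)
  have h1 : ‖c 0‖ ^ 2 + ‖c 1‖ ^ 2 = ‖c 0 + c 1‖ ^ 2 := by
    rw [norm_add_sq_real, inner_blockPart s t a (by norm_num)]
    ring
  have h2 : α ^ 2 * ‖c 0 + c 1‖ ^ 2 ≤ ‖G (c 0 + c 1)‖ ^ 2 := by
    rw [← mul_pow]
    have := (hG.blockPart_pair hst ht a 0 1 1 1).1
    simp only [one_smul] at this
    exact pow_le_pow_left₀ (by positivity) this 2
  have h3 : ‖G (c 0 + c 1)‖ ^ 2 ≤ (β ^ 2 - α ^ 2) / 2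
      * ((∑ k ∈ Finset.range N, ‖c (k + 2)‖) * (‖c 0‖ + ‖c 1‖)) := by
    rw [← real_inner_self_eq_norm_sq]
    nth_rewrite 2 [hsum]
    rw [inner_neg_right, inner_sum, ← Finset.sum_neg_distrib, Finset.sum_mul, Finset.mul_sum]
    refine Finset.sum_le_sum fun k _ => ?_
    rw [map_add, inner_add_left]
    have h4 := hpair 0 (k + 2) (by omega)
    have h5 := hpair 1 (k + 2) (by omega)
    linarith
  rw [h1]
  have h4 := h2.trans h3
  rw [mul_comm, ← le_div_iff₀ (by positivity)] at h4
  refine h4.trans_eq ?_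
  field_simp

theorem IsRestrictedIsometry.norm_le (hG : IsRestrictedIsometry G α β (2 * t))
    (hα : 0 < α) (hαβ : α ≤ β) (hst : s ≤ t) (ht : 0 < t) {p : ℝ} (hp : 0 < p) (hp1 : p ≤ 1)
    {a : EuclideanSpace ℝ (Fin N)}
    (hGa : G a = 0) (ha : Antitone a) (ha0 : ∀ i, 0 ≤ a i) {D : ℝ}
    (hD : D = (∑ i : Fin N, if s ≤ (i : ℕ) then a i ^ p else 0) ^ (1 / p)
        * (t : ℝ) ^ (1 / 2 - 1 / p)) :
    ‖blockPart s t a 0‖ ≤ (1 + √2) / 4 * (β ^ 2 / α ^ 2 - 1) * D ∧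
      ‖a‖ ≤ (1 + (1 + √2) / 2 * (β ^ 2 / α ^ 2 - 1)) * D := by
  have hδ : 0 ≤ β ^ 2 / α ^ 2 - 1 := by
    rw [sub_nonneg, le_div_iff₀ (by positivity), one_mul]
    exact pow_le_pow_left₀ hα.le hαβ 2
  set δ := β ^ 2 / α ^ 2 - 1
  have hsum := sum_norm_blockPart_le hp hp1 hst ht ha ha0
  rw [← hD] at hsum
  have hD0 : 0 ≤ D := (Finset.sum_nonneg fun _ _ => norm_nonneg _).trans hsum
  have key : ‖blockPart s t a 0‖ ^ 2 + ‖blockPart s t a 1‖ ^ 2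
      ≤ δ / 2 * D * (‖blockPart s t a 0‖ + ‖blockPart s t a 1‖) := by
    refine (hG.norm_blockPart_sq_add_le hα hst ht hGa).trans ?_
    gcongr
  have h0 := le_of_sq_add_sq_le (by positivity) key
  have h1 := le_of_sq_add_sq_le (x := ‖blockPart s t a 1‖) (y := ‖blockPart s t a 0‖)
    (S := δ / 2 * D)
    (by positivity) (by linarith)
  refine ⟨by linarith, ?_⟩
  have h2 : ‖a‖ ≤ ∑ k ∈ Finset.range (N + 2), ‖blockPart s t a k‖ := by
    conv_lhs => rw [← sum_blockPart s t a]
    exact norm_sum_le _ _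
  rw [Finset.sum_range_succ', Finset.sum_range_succ'] at h2
  simp only [zero_add] at h2
  have h3 : ∑ k ∈ Finset.range N, ‖blockPart s t a (k + 1 + 1)‖ ≤ D := hsum
  linarith

/-- Hölder on the first block, of at most s entries, turns its ℓ₂ bound into an ℓ_p bound at the
cost of s ^ (1/p - 1/2); combined with the factor t ^ (1/2 - 1/p) this produces the power of s/t. -/
theorem IsRestrictedIsometry.sum_rpow_le (hG : IsRestrictedIsometry G α β (2 * t))
    (hα : 0 < α) (hαβ : α ≤ β) (hst : s ≤ t) (ht : 0 < t) {p : ℝ} (hp : 0 < p) (hp1 : p ≤ 1)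
    {a : EuclideanSpace ℝ (Fin N)} (hGa : G a = 0) (ha : Antitone a) (ha0 : ∀ i, 0 ≤ a i) :
    (∑ i : Fin N, if s ≤ (i : ℕ) then 0 else a i ^ p)
      ≤ ((1 + √2) / 4 * (β ^ 2 / α ^ 2 - 1) * ((s : ℝ) / t) ^ (1 / p - 1 / 2)) ^ p
        * ∑ i : Fin N, if s ≤ (i : ℕ) then a i ^ p else 0 := by
  have hnorm := (hG.norm_le hα hαβ hst ht hp hp1 hGa ha ha0 rfl).1
  set τ := ∑ i : Fin N, if s ≤ (i : ℕ) then a i ^ p else 0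
  have h0 : ∀ i, 0 ≤ a i ^ p := fun i => Real.rpow_nonneg (ha0 i) _
  have hτ : 0 ≤ τ := Finset.sum_nonneg fun i _ => by split_ifs; exacts [h0 i, le_rfl]
  have hδ : 0 ≤ β ^ 2 / α ^ 2 - 1 := by
    rw [sub_nonneg, le_div_iff₀ (by positivity), one_mul]
    exact pow_le_pow_left₀ hα.le hαβ 2
  set δ := β ^ 2 / α ^ 2 - 1
  have ht' : (0 : ℝ) < t := by exact_mod_cast ht
  have h1 : (∑ i : Fin N, if s ≤ (i : ℕ) then 0 else a i ^ p)
      = ∑ i ∈ blockSet N s t 0, a i ^ p := by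
    rw [blockSet, Finset.sum_filter]
    refine Finset.sum_congr rfl fun i _ => ?_
    simp only [blockIndex_eq_zero]
    by_cases h : s ≤ (i : ℕ)
    · rw [if_pos h, if_neg (by omega)]
    · rw [if_neg h, if_pos (by omega)]
  rw [h1]
  set x := ∑ i ∈ blockSet N s t 0, a i ^ p
  have hx : 0 ≤ x := Finset.sum_nonneg fun i _ => h0 i
  have hp2 : 1 ≤ 2 / p := by rw [le_div_iff₀ hp]; linarith
  have h2 := Real.rpow_sum_le_const_mul_sum_rpow (s := blockSet N s t 0) (fun i => a i ^ p) hp2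
  have h3 : ∀ i, (a i ^ p) ^ (2 / p) = a i ^ 2 := by
    intro i
    rw [← Real.rpow_mul (ha0 i), mul_div_cancel₀ _ hp.ne',
      Real.rpow_two]
  simp only [abs_of_nonneg (h0 _), h3] at h2
  rw [← norm_sq_blockPart] at h2
  have h4 : x ^ (1 / p) ≤ (s : ℝ) ^ (1 / p - 1 / 2) * ‖blockPart s t a 0‖ := by
    refine le_of_sq_le_sq ?_ (by positivity)
    rw [mul_pow, ← Real.rpow_natCast, ← Real.rpow_natCast ((s : ℝ) ^ _), ← Real.rpow_mul hx,
      ← Real.rpow_mul (by positivity)]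
    have e1 : 1 / p * ((2 : ℕ) : ℝ) = 2 / p := by push_cast; ring
    have e2 : (1 / p - 1 / 2) * ((2 : ℕ) : ℝ) = 2 / p - 1 := by push_cast; ring
    rw [e1, e2]
    refine h2.trans ?_
    gcongr
    exact card_blockSet_zero_le N s t
  have h5 : x ^ (1 / p) ≤ (1 + √2) / 4 * δ * ((s : ℝ) / t) ^ (1 / p - 1 / 2) * τ ^ (1 / p) := by
    refine h4.trans ((mul_le_mul_of_nonneg_left hnorm (by positivity)).trans_eq ?_)
    rw [Real.div_rpow (by positivity) ht'.le, show (1 : ℝ) / 2 - 1 / p = -(1 / p - 1 / 2) by ring,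
      Real.rpow_neg ht'.le]
    ring
  have h6 := Real.rpow_le_rpow (by positivity) h5 hp.le
  rwa [Real.mul_rpow (by positivity) (by positivity), ← Real.rpow_mul hx, ← Real.rpow_mul hτ,
    one_div_mul_cancel hp.ne', Real.rpow_one, Real.rpow_one] at h6

end Kernel

end

/-! ### Schatten quantities of matrices: head, tail, rank error, continuity. -/

section

variable {N : ℕ}

/-- The sum of the `p`-th powers of the singular values. -/
def schattenPow (p : ℝ) (X : Matrix (Fin N) (Fin N) ℝ) : ℝ :=
  ∑ i : Fin N, ((Matrix.toEuclideanLin X).singularValues (i : ℕ)) ^ p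

/-- The sum of the `p`-th powers of the first `s` singular values. -/
def schattenHead (p : ℝ) (s : ℕ) (X : Matrix (Fin N) (Fin N) ℝ) : ℝ :=
  ∑ i : Fin N, if s ≤ (i : ℕ) then 0 else ((Matrix.toEuclideanLin X).singularValues (i : ℕ)) ^ p

/-- The sum of the `p`-th powers of all but the first `s` singular values. -/
def schattenTail (p : ℝ) (s : ℕ) (X : Matrix (Fin N) (Fin N) ℝ) : ℝ :=
  ∑ i : Fin N, if s ≤ (i : ℕ) then ((Matrix.toEuclideanLin X).singularValues (i : ℕ)) ^ p else 0

theorem rpow_singularValues_nonneg (p : ℝ) (X : Matrix (Fin N) (Fin N) ℝ) (i : ℕ) :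
    0 ≤ ((Matrix.toEuclideanLin X).singularValues i) ^ p :=
  Real.rpow_nonneg (LinearMap.singularValues_nonneg _ _) _

theorem schattenPow_nonneg (p : ℝ) (X : Matrix (Fin N) (Fin N) ℝ) : 0 ≤ schattenPow p X :=
  Finset.sum_nonneg fun _ _ => rpow_singularValues_nonneg p X _

theorem schattenHead_nonneg (p : ℝ) (s : ℕ) (X : Matrix (Fin N) (Fin N) ℝ) :
    0 ≤ schattenHead p s X :=
  Finset.sum_nonneg fun _ _ => by
    split_ifs
    exacts [le_rfl, rpow_singularValues_nonneg p X _]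

theorem schattenTail_nonneg (p : ℝ) (s : ℕ) (X : Matrix (Fin N) (Fin N) ℝ) :
    0 ≤ schattenTail p s X :=
  Finset.sum_nonneg fun _ _ => by
    split_ifs
    exacts [rpow_singularValues_nonneg p X _, le_rfl]

theorem schattenHead_add_schattenTail (p : ℝ) (s : ℕ) (X : Matrix (Fin N) (Fin N) ℝ) :
    schattenHead p s X + schattenTail p s X = schattenPow p X := by
  rw [schattenHead, schattenTail, schattenPow, ← Finset.sum_add_distrib]
  refine Finset.sum_congr rfl fun i _ => ?_
  split_ifs <;> simp

theorem schattenNorm_eq (p : ℝ) (X : Matrix (Fin N) (Fin N) ℝ) :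
    schattenNorm p X = schattenPow p X ^ (1 / p) := rfl

theorem schattenNorm_nonneg (p : ℝ) (X : Matrix (Fin N) (Fin N) ℝ) : 0 ≤ schattenNorm p X :=
  Real.rpow_nonneg (schattenPow_nonneg p X) _

theorem schattenNorm_le_iff {p : ℝ} (hp : 0 < p) (X Y : Matrix (Fin N) (Fin N) ℝ) :
    schattenNorm p X ≤ schattenNorm p Y ↔ schattenPow p X ≤ schattenPow p Y :=
  Real.rpow_le_rpow_iff (schattenPow_nonneg p X) (schattenPow_nonneg p Y) (by positivity)

theorem rank_eq_finrank_range_toEuclideanLin (X : Matrix (Fin N) (Fin N) ℝ) :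
    X.rank = finrank ℝ (LinearMap.range (Matrix.toEuclideanLin X)) := by
  rw [X.rank_eq_finrank_range_toLin (PiLp.basisFun 2 ℝ (Fin N)) (PiLp.basisFun 2 ℝ (Fin N)),
    ← Matrix.toLpLin_eq_toLin]

/-- Mirsky's concave inequality, for `x ^ p` and matrices. -/
theorem sum_abs_rpow_sub_le_schattenPow {p : ℝ} (hp : 0 < p) (hp1 : p ≤ 1)
    (X Y : Matrix (Fin N) (Fin N) ℝ) :
    ∑ i : Fin N, |(Matrix.toEuclideanLin X).singularValues i ^ p
      - (Matrix.toEuclideanLin Y).singularValues i ^ p| ≤ schattenPow p (Y - X) := by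
  have := sum_abs_rpow_singularValues_sub_le hp hp1 (finrank_euclideanSpace_fin (𝕜 := ℝ) (n := N))
    (Matrix.toEuclideanLin X) (Matrix.toEuclideanLin (Y - X))
  rwa [← map_add, add_sub_cancel] at this

theorem abs_schattenPow_sub_le {p : ℝ} (hp : 0 < p) (hp1 : p ≤ 1)
    (X Y : Matrix (Fin N) (Fin N) ℝ) :
    |schattenPow p X - schattenPow p Y| ≤ schattenPow p (Y - X) := by
  refine le_trans ?_ (sum_abs_rpow_sub_le_schattenPow hp hp1 X Y)
  rw [schattenPow, schattenPow, ← Finset.sum_sub_distrib]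
  exact Finset.abs_sum_le_sum_abs _ _

/-- Mirsky's inequality is applied to X - X' and X, whose difference is X', and the power sum of X'
is at most head(X) + tail(X). The absolute values are bounded below with opposite signs on head and
tail. -/
theorem schattenTail_sub_le {p : ℝ} (hp : 0 < p) (hp1 : p ≤ 1) (s : ℕ)
    {X X' : Matrix (Fin N) (Fin N) ℝ} (h : schattenPow p X' ≤ schattenPow p X) :
    schattenTail p s (X - X') ≤ schattenHead p s (X - X') + 2 * schattenTail p s X := by
  have h1 := sum_abs_rpow_sub_le_schattenPow hp hp1 (X - X') X
  rw [sub_sub_cancel] at h1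
  have h2 : schattenHead p s X - schattenHead p s (X - X')
      + (schattenTail p s (X - X') - schattenTail p s X) ≤
      ∑ i : Fin N, |(Matrix.toEuclideanLin (X - X')).singularValues i ^ p
      - (Matrix.toEuclideanLin X).singularValues i ^ p| := by
    simp only [schattenHead, schattenTail]
    rw [← Finset.sum_sub_distrib, ← Finset.sum_sub_distrib, ← Finset.sum_add_distrib]
    refine Finset.sum_le_sum fun i _ => ?_
    split_ifs
    · rw [sub_zero, zero_add]
      exact le_abs_self _
    · rw [sub_zero, add_zero, abs_sub_comm]
      exact le_abs_self _
  have h3 := schattenHead_add_schattenTail p s X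
  linarith

/-- Adding back Y, of rank at most s, shifts singular values by at most s places. This is the half
of Eckart–Young that is needed. -/
theorem schattenTail_le_schattenPow_sub {p : ℝ} (hp : 0 < p) {s : ℕ}
    (X : Matrix (Fin N) (Fin N) ℝ) {Y : Matrix (Fin N) (Fin N) ℝ} (hY : Y.rank ≤ s) :
    schattenTail p s X ≤ schattenPow p (X - Y) := by
  have h : ∀ i, (Matrix.toEuclideanLin X).singularValues (i + s)
      ≤ (Matrix.toEuclideanLin (X - Y)).singularValues i := by
    intro i
    have := singularValues_add_le (Matrix.toEuclideanLin (X - Y)) (Matrix.toEuclideanLin Y)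
      (k := s) (by rwa [← rank_eq_finrank_range_toEuclideanLin]) i
    rwa [← map_add, sub_add_cancel] at this
  rw [schattenTail, schattenPow,
    ← Finset.sum_range (fun i => if s ≤ i then
      (Matrix.toEuclideanLin X).singularValues i ^ p else 0),
    ← Finset.sum_range (fun i => (Matrix.toEuclideanLin (X - Y)).singularValues i ^ p)]
  -- The range is lengthened so that removing its first s indices leaves exactly N terms.
  calc _ ≤ ∑ i ∈ Finset.range (s + N), (if s ≤ i then
        (Matrix.toEuclideanLin X).singularValues i ^ p else 0) := by
        refine Finset.sum_le_sum_of_subset_of_nonneg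
          (Finset.range_subset_range.2 (by omega)) fun i _ _ => ?_
        split_ifs
        exacts [rpow_singularValues_nonneg p X _, le_rfl]
    _ ≤ _ := by
        rw [Finset.sum_range_add, Finset.sum_eq_zero (s := Finset.range s), zero_add]
        · refine Finset.sum_le_sum fun i _ => ?_
          rw [if_pos (by omega), add_comm]
          exact Real.rpow_le_rpow (LinearMap.singularValues_nonneg _ _) (h i) hp.le
        · intro i hi
          rw [if_neg (by simpa using hi)]

theorem schattenPow_zero {p : ℝ} (hp : 0 < p) :
    schattenPow p (0 : Matrix (Fin N) (Fin N) ℝ) = 0 := by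
  simp [schattenPow, Real.zero_rpow hp.ne']

theorem schattenTail_eq_zero {p : ℝ} (hp : 0 < p) {s : ℕ} {X : Matrix (Fin N) (Fin N) ℝ}
    (hX : X.rank ≤ s) : schattenTail p s X = 0 := by
  have := schattenTail_le_schattenPow_sub hp X hX
  rw [sub_self, schattenPow_zero hp] at this
  exact le_antisymm this (schattenTail_nonneg _ _ _)

theorem rpow_schattenTail_le_rankError {p : ℝ} (hp : 0 < p) (s : ℕ)
    (X : Matrix (Fin N) (Fin N) ℝ) : schattenTail p s X ^ (1 / p) ≤ rankError p s X := by
  refine le_csInf ⟨_, 0, by simp, rfl⟩ ?_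
  rintro _ ⟨Y, hY, rfl⟩
  exact Real.rpow_le_rpow (schattenTail_nonneg _ _ _) (schattenTail_le_schattenPow_sub hp X hY)
    (by positivity)

theorem sum_sq_singularValues {E : Type*} [NormedAddCommGroup E] [InnerProductSpace ℝ E]
    [FiniteDimensional ℝ E] (T : E →ₗ[ℝ] E) (b : OrthonormalBasis (Fin N) ℝ E) :
    ∑ i : Fin N, T.singularValues i ^ 2 = ∑ i, ‖T (b i)‖ ^ 2 := by
  have hn : finrank ℝ E = N := by rw [finrank_eq_card_basis b.toBasis, Fintype.card_fin]
  have h1 := T.isSymmetric_adjoint_comp_self.trace_eq_sum_eigenvalues hn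
  have h2 := LinearMap.trace_eq_sum_inner (T.adjoint ∘ₗ T) b
  simp only [T.sq_singularValues_fin hn]
  refine h1.symm.trans (h2.trans (Finset.sum_congr rfl fun i _ => ?_))
  rw [LinearMap.comp_apply, LinearMap.adjoint_inner_right, real_inner_self_eq_norm_sq]

theorem schattenNorm_two (X : Matrix (Fin N) (Fin N) ℝ) :
    schattenNorm 2 X = √(∑ i : Fin N, (Matrix.toEuclideanLin X).singularValues i ^ 2) := by
  rw [schattenNorm, Real.sqrt_eq_rpow]
  simp only [Real.rpow_two]

theorem schattenNorm_two_eq_of_basis (X : Matrix (Fin N) (Fin N) ℝ)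
    (b : OrthonormalBasis (Fin N) ℝ (EuclideanSpace ℝ (Fin N))) :
    schattenNorm 2 X = √(∑ i, ‖Matrix.toEuclideanLin X (b i)‖ ^ 2) := by
  rw [schattenNorm_two, sum_sq_singularValues _ b]

/-- The Schatten `2`-norm is the Frobenius norm. -/
theorem schattenNorm_two_eq_sqrt_sum (X : Matrix (Fin N) (Fin N) ℝ) :
    schattenNorm 2 X = √(∑ j, ∑ i, X i j ^ 2) := by
  rw [schattenNorm_two_eq_of_basis X (EuclideanSpace.basisFun (Fin N) ℝ)]
  congr 1
  refine Finset.sum_congr rfl fun j _ => ?_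
  rw [EuclideanSpace.norm_sq_eq]
  refine Finset.sum_congr rfl fun i _ => ?_
  simp [Matrix.toLpLin_apply]

theorem abs_apply_le_schattenNorm_two (X : Matrix (Fin N) (Fin N) ℝ) (i j : Fin N) :
    |X i j| ≤ schattenNorm 2 X := by
  rw [schattenNorm_two_eq_sqrt_sum, ← Real.sqrt_sq_eq_abs]
  refine Real.sqrt_le_sqrt ?_
  refine le_trans ?_ (Finset.single_le_sum (fun j _ => Finset.sum_nonneg fun i _ => sq_nonneg _)
    (Finset.mem_univ j))
  exact Finset.single_le_sum (f := fun i => X i j ^ 2) (fun i _ => sq_nonneg _) (Finset.mem_univ i)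

theorem schattenNorm_two_le {p : ℝ} (hp : 0 < p) (hp1 : p ≤ 1) (X : Matrix (Fin N) (Fin N) ℝ) :
    schattenNorm 2 X ≤ schattenNorm p X := by
  rw [schattenNorm_two, schattenNorm_eq]
  have h0 := Real.rpow_nonneg (schattenPow_nonneg p X) (1 / p)
  rw [Real.sqrt_le_left h0, ← Real.rpow_natCast, ← Real.rpow_mul (schattenPow_nonneg p X)]
  have h1 := sum_rpow_le_rpow_sum Finset.univ
    (fun i : Fin N => (Matrix.toEuclideanLin X).singularValues i ^ p)
    (fun i _ => rpow_singularValues_nonneg p X i)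
    (q := 2 / p) (by rw [le_div_iff₀ hp]; linarith)
  rw [show 1 / p * ((2 : ℕ) : ℝ) = 2 / p by push_cast; ring]
  refine le_trans (Finset.sum_le_sum fun i _ => le_of_eq ?_) h1
  rw [← Real.rpow_mul (LinearMap.singularValues_nonneg _ _), mul_div_cancel₀ _ hp.ne',
    Real.rpow_two]

theorem schattenPow_le (p : ℝ) (hp : 0 < p) (X : Matrix (Fin N) (Fin N) ℝ) :
    schattenPow p X ≤ N * schattenNorm 2 X ^ p := by
  have h : ∀ i ∈ (Finset.univ : Finset (Fin N)),
      (Matrix.toEuclideanLin X).singularValues i ^ p ≤ schattenNorm 2 X ^ p := by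
    intro i hi
    refine Real.rpow_le_rpow (LinearMap.singularValues_nonneg _ _) ?_ hp.le
    rw [schattenNorm_two]
    refine Real.le_sqrt_of_sq_le ?_
    exact Finset.single_le_sum
      (f := fun i : Fin N => (Matrix.toEuclideanLin X).singularValues i ^ 2)
      (fun i _ => sq_nonneg _) hi
  simpa [schattenPow] using Finset.sum_le_card_nsmul _ _ _ h

/-- The increment is at most N ‖X - Y‖_{S₂}^p, and the Schatten 2-norm is the Frobenius norm,
visibly continuous in the entries. -/
theorem continuous_schattenPow {p : ℝ} (hp : 0 < p) (hp1 : p ≤ 1) :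
    Continuous (schattenPow p : Matrix (Fin N) (Fin N) ℝ → ℝ) := by
  rw [continuous_iff_continuousAt]
  intro X
  rw [ContinuousAt, tendsto_iff_dist_tendsto_zero]
  have h1 : Continuous fun Y : Matrix (Fin N) (Fin N) ℝ => N * schattenNorm 2 (X - Y) ^ p := by
    simp only [schattenNorm_two_eq_sqrt_sum]
    refine continuous_const.mul (Continuous.rpow_const ?_ fun _ => Or.inr hp.le)
    fun_prop
  have h2 : Filter.Tendsto (fun Y : Matrix (Fin N) (Fin N) ℝ => N * schattenNorm 2 (X - Y) ^ p)
      (nhds X) (nhds 0) := by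
    have := h1.tendsto X
    rwa [sub_self, schattenNorm_two_eq_sqrt_sum, show (√(∑ j : Fin N, ∑ i : Fin N,
      (0 : Matrix (Fin N) (Fin N) ℝ) i j ^ 2)) = 0 by simp, Real.zero_rpow hp.ne', mul_zero] at this
  refine squeeze_zero (fun _ => dist_nonneg) (fun Y => ?_) h2
  rw [Real.dist_eq]
  exact (abs_schattenPow_sub_le hp hp1 Y X).trans (schattenPow_le p hp _)

/-! ### Existence of minimisers and attainment of the constants α and β. -/

variable {m : ℕ} (A : Matrix (Fin N) (Fin N) ℝ →ₗ[ℝ] EuclideanSpace ℝ (Fin m))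

theorem exists_isSolution {p : ℝ} (hp : 0 < p) (hp1 : p ≤ 1) (X : Matrix (Fin N) (Fin N) ℝ) :
    ∃ X', IsSolution p A (A X) X' := by
  set R := schattenNorm p X
  set K : Set (Matrix (Fin N) (Fin N) ℝ) :=
    {Z | A Z = A X} ∩ {Z | schattenPow p Z ≤ schattenPow p X}
  have hbox : IsCompact {Z : Matrix (Fin N) (Fin N) ℝ | ∀ i j, Z i j ∈ Set.Icc (-R) R} := by
    have := isCompact_univ_pi fun _ : Fin N => isCompact_univ_pi fun _ : Fin N =>
      (isCompact_Icc : IsCompact (Set.Icc (-R) R))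
    convert! this using 1
    ext Z
    exact ⟨fun h i _ j _ => h i j, fun h i j => h i trivial j trivial⟩
  have hK : IsCompact K := by
    refine hbox.of_isClosed_subset ?_ ?_
    · exact (isClosed_eq A.continuous_of_finiteDimensional continuous_const).inter
        (isClosed_le (continuous_schattenPow hp hp1) continuous_const)
    · rintro Z ⟨-, hZ⟩ i j
      exact abs_le.1 ((abs_apply_le_schattenNorm_two Z i j).trans
        ((schattenNorm_two_le hp hp1 Z).trans ((schattenNorm_le_iff hp Z X).2 hZ)))
  obtain ⟨X', hX', hmin⟩ := hK.exists_isMinOn ⟨X, rfl, le_refl (schattenPow p X)⟩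
    (continuous_schattenPow hp hp1).continuousOn
  refine ⟨X', hX'.1, fun Z hZ => (schattenNorm_le_iff hp _ _).2 ?_⟩
  rcases le_total (schattenPow p Z) (schattenPow p X) with h | h
  · exact hmin ⟨hZ, h⟩
  · exact hX'.2.trans h

theorem lowerConst_mul_le {k : ℕ} {Z : Matrix (Fin N) (Fin N) ℝ} (hZ : Z.rank ≤ k) :
    lowerConst A k * schattenNorm 2 Z ≤ ‖A Z‖ := by
  rcases eq_or_lt_of_le (schattenNorm_nonneg 2 Z) with h | h
  · rw [← h, mul_zero]
    exact norm_nonneg _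
  · rw [← le_div_iff₀ h]
    refine csSup_le ⟨0, le_rfl, fun Z _ => by simp⟩ ?_
    rintro a ⟨-, ha⟩
    rw [le_div_iff₀ h]
    exact ha Z hZ

/-- A finite bound, however crude, makes the set defining `upperConst` nonempty, so that its infimum
is not a default value. -/
theorem norm_map_le (Z : Matrix (Fin N) (Fin N) ℝ) :
    ‖A Z‖ ≤ (∑ i, ∑ j, ‖A (Matrix.single i j 1)‖) * schattenNorm 2 Z := by
  conv_lhs => rw [Matrix.matrix_eq_sum_single Z, map_sum]
  refine (norm_sum_le _ _).trans ?_
  rw [Finset.sum_mul]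
  refine Finset.sum_le_sum fun i _ => ?_
  rw [map_sum]
  refine (norm_sum_le _ _).trans ?_
  rw [Finset.sum_mul]
  refine Finset.sum_le_sum fun j _ => ?_
  have : Matrix.single i j (Z i j) = Z i j • Matrix.single i j (1 : ℝ) := by
    rw [Matrix.smul_single, smul_eq_mul, mul_one]
  rw [this, map_smul, norm_smul, mul_comm]
  exact mul_le_mul_of_nonneg_left (abs_apply_le_schattenNorm_two Z i j) (norm_nonneg _)

theorem norm_map_le_upperConst {k : ℕ} {Z : Matrix (Fin N) (Fin N) ℝ} (hZ : Z.rank ≤ k) :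
    ‖A Z‖ ≤ upperConst A k * schattenNorm 2 Z := by
  have hne : {b : ℝ | 0 ≤ b ∧ ∀ Z : Matrix (Fin N) (Fin N) ℝ, Z.rank ≤ k →
      ‖A Z‖ ≤ b * schattenNorm 2 Z}.Nonempty :=
    ⟨_, Finset.sum_nonneg fun i _ => Finset.sum_nonneg fun j _ => norm_nonneg _,
      fun Z _ => norm_map_le A Z⟩
  rcases eq_or_lt_of_le (schattenNorm_nonneg 2 Z) with h | h
  · have := norm_map_le A Z
    rwa [← h, mul_zero] at this ⊢
  · rw [← div_le_iff₀ h]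
    refine le_csInf hne ?_
    rintro b ⟨-, hb⟩
    rw [div_le_iff₀ h]
    exact hb Z hZ

theorem lowerConst_le_upperConst {k : ℕ} (hk : 1 ≤ k) (hA : 0 < lowerConst A k) :
    lowerConst A k ≤ upperConst A k := by
  rcases Nat.eq_zero_or_pos N with rfl | hN
  · exfalso
    -- For N = 0 every a ≥ 0 is admissible, so the real supremum takes its default value 0, contrary
    -- to α > 0.
    refine hA.ne' (Real.sSup_of_not_bddAbove ?_)
    rintro ⟨M, hM⟩
    have h := hM (a := |M| + 1) ⟨by positivity, fun Z _ => by simp [schattenNorm]⟩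
    linarith [le_abs_self M]
  · set Z : Matrix (Fin N) (Fin N) ℝ := Matrix.vecMulVec 1 1 with hZdef
    have hZ : Z.rank ≤ k := (Matrix.rank_vecMulVec_le _ _).trans hk
    have h1 : 0 < schattenNorm 2 Z := by
      refine lt_of_lt_of_le ?_ (abs_apply_le_schattenNorm_two Z ⟨0, hN⟩ ⟨0, hN⟩)
      simp [hZdef]
    exact le_of_mul_le_mul_right ((lowerConst_mul_le A hZ).trans (norm_map_le_upperConst A hZ)) h1

/-! ### Transfer from matrices to vectors along fixed singular vectors. -/

/-- The matrix with singular vectors `u`, `v` and coefficients `z`. -/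
def ofSingularVectors (u v : OrthonormalBasis (Fin N) ℝ (EuclideanSpace ℝ (Fin N))) :
    EuclideanSpace ℝ (Fin N) →ₗ[ℝ] Matrix (Fin N) (Fin N) ℝ where
  toFun z := ∑ i, z i • Matrix.toEuclideanLin.symm
    (InnerProductSpace.rankOne ℝ (u i) (v i)).toLinearMap
  map_add' x y := by simp [add_smul, Finset.sum_add_distrib]
  map_smul' c x := by simp [mul_smul, Finset.smul_sum]

theorem toEuclideanLin_ofSingularVectors
    (u v : OrthonormalBasis (Fin N) ℝ (EuclideanSpace ℝ (Fin N)))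
    (z x : EuclideanSpace ℝ (Fin N)) :
    Matrix.toEuclideanLin (ofSingularVectors u v z) x = ∑ i, (z i * inner ℝ (v i) x) • u i := by
  simp [ofSingularVectors, smul_smul]

theorem schattenNorm_two_ofSingularVectors
    (u v : OrthonormalBasis (Fin N) ℝ (EuclideanSpace ℝ (Fin N)))
    (z : EuclideanSpace ℝ (Fin N)) : schattenNorm 2 (ofSingularVectors u v z) = ‖z‖ := by
  rw [schattenNorm_two_eq_of_basis _ v, EuclideanSpace.norm_eq]
  congr 1
  refine Finset.sum_congr rfl fun i _ => ?_
  rw [toEuclideanLin_ofSingularVectors]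
  simp [v.inner_eq_ite, norm_smul]

theorem rank_ofSingularVectors_le
    (u v : OrthonormalBasis (Fin N) ℝ (EuclideanSpace ℝ (Fin N)))
    {S : Finset (Fin N)} {z : EuclideanSpace ℝ (Fin N)} (hz : ∀ i, i ∉ S → z i = 0) :
    (ofSingularVectors u v z).rank ≤ S.card := by
  rw [rank_eq_finrank_range_toEuclideanLin, ← finrank_span_image u S]
  refine Submodule.finrank_mono ?_
  rintro _ ⟨x, rfl⟩
  rw [toEuclideanLin_ofSingularVectors]
  refine Submodule.sum_mem _ fun i _ => ?_
  by_cases hi : i ∈ S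
  · exact Submodule.smul_mem _ _ (Submodule.subset_span ⟨i, hi, rfl⟩)
  · rw [hz i hi, zero_mul, zero_smul]
    exact Submodule.zero_mem _

theorem exists_eq_ofSingularVectors (X : Matrix (Fin N) (Fin N) ℝ) :
    ∃ u v : OrthonormalBasis (Fin N) ℝ (EuclideanSpace ℝ (Fin N)),
      X = ofSingularVectors u v
        (WithLp.toLp 2 fun i : Fin N => (Matrix.toEuclideanLin X).singularValues i) := by
  obtain ⟨u, v, huv⟩ := exists_svd finrank_euclideanSpace_fin (Matrix.toEuclideanLin X)
  refine ⟨u, v, Matrix.toEuclideanLin.injective (v.toBasis.ext fun j => ?_)⟩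
  rw [toEuclideanLin_ofSingularVectors]
  simp [v.inner_eq_ite, huv]

theorem isRestrictedIsometry_comp_ofSingularVectors
    (u v : OrthonormalBasis (Fin N) ℝ (EuclideanSpace ℝ (Fin N))) (k : ℕ) :
    IsRestrictedIsometry (A ∘ₗ ofSingularVectors u v) (lowerConst A k) (upperConst A k) k := by
  intro S hS z hz
  have h := (rank_ofSingularVectors_le u v hz).trans hS
  rw [← schattenNorm_two_ofSingularVectors u v z]
  exact ⟨lowerConst_mul_le A h, norm_map_le_upperConst A h⟩

/-- The null space property of order `s`. -/
theorem schattenHead_le_of_map_eq_zero {s t : ℕ} (hst : s ≤ t) (ht : 0 < t)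
    (hA : 0 < lowerConst A (2 * t)) {p : ℝ} (hp : 0 < p) (hp1 : p ≤ 1)
    {V : Matrix (Fin N) (Fin N) ℝ} (hV : A V = 0) :
    schattenHead p s V ≤ ((1 + √2) / 4 * (gammaConst A (2 * t) - 1)
        * ((s : ℝ) / t) ^ (1 / p - 1 / 2)) ^ p * schattenTail p s V ∧
      schattenNorm 2 V ≤ (1 + (1 + √2) / 2 * (gammaConst A (2 * t) - 1))
        * (schattenTail p s V ^ (1 / p) * (t : ℝ) ^ (1 / 2 - 1 / p)) := by
  obtain ⟨u, v, huv⟩ := exists_eq_ofSingularVectors V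
  set a : EuclideanSpace ℝ (Fin N) :=
    WithLp.toLp 2 fun i : Fin N => (Matrix.toEuclideanLin V).singularValues i with ha
  have hG := isRestrictedIsometry_comp_ofSingularVectors A u v (2 * t)
  have hGa : (A ∘ₗ ofSingularVectors u v) a = 0 := by
    rw [LinearMap.comp_apply, ← huv, hV]
  have hαβ := lowerConst_le_upperConst A (by omega) hA
  have hanti : Antitone a := fun i j hij =>
    (Matrix.toEuclideanLin V).singularValues_antitone (Fin.le_def.1 hij)
  have ha0 : ∀ i, 0 ≤ a i := fun i => (Matrix.toEuclideanLin V).singularValues_nonneg i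
  refine ⟨hG.sum_rpow_le hA hαβ hst ht hp hp1 hGa hanti ha0, ?_⟩
  have h2 : schattenNorm 2 V = ‖a‖ := by
    rw [← schattenNorm_two_ofSingularVectors u v a, ← huv]
  rw [h2]
  exact (hG.norm_le hA hαβ hst ht hp hp1 hGa hanti ha0 rfl).2

theorem eq_zero_of_schattenPow_eq_zero {p : ℝ} (hp : 0 < p) (hp1 : p ≤ 1)
    {V : Matrix (Fin N) (Fin N) ℝ} (hV : schattenPow p V = 0) : V = 0 := by
  ext i j
  have h := (abs_apply_le_schattenNorm_two V i j).trans (schattenNorm_two_le hp hp1 V)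
  rw [schattenNorm_eq, hV, Real.zero_rpow (by positivity)] at h
  exact abs_nonpos_iff.1 h

/-- The constant in the null space property. -/
def nullSpaceConst (p γ r : ℝ) : ℝ := ((1 + √2) / 4 * (γ - 1) * r ^ (1 / p - 1 / 2)) ^ p

theorem nullSpaceConst_lt_one {p γ s t : ℝ} (hp : 0 < p) (hs : 0 < s) (ht : 0 < t) (hγ : 1 ≤ γ)
    (h : γ - 1 < 4 * (√2 - 1) * (t / s) ^ (1 / p - 1 / 2)) : nullSpaceConst p γ (s / t) < 1 := by
  have h0 : 0 ≤ γ - 1 := by linarith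
  refine Real.rpow_lt_one (by positivity) ?_ hp
  have h1 : (s / t) ^ (1 / p - 1 / 2) * (t / s) ^ (1 / p - 1 / 2) = 1 := by
    rw [← Real.mul_rpow (by positivity) (by positivity), div_mul_div_comm, mul_comm s t,
      div_self (by positivity), Real.one_rpow]
  -- The source of the threshold 4(√2 - 1): it is the reciprocal of (1 + √2)/4.
  have h2 : (√2 : ℝ) * √2 = 2 := Real.mul_self_sqrt (by norm_num)
  calc (1 + √2) / 4 * (γ - 1) * (s / t) ^ (1 / p - 1 / 2)
      < (1 + √2) / 4 * (4 * (√2 - 1) * (t / s) ^ (1 / p - 1 / 2))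
        * (s / t) ^ (1 / p - 1 / 2) := by gcongr
    _ = (√2 * √2 - 1) * ((s / t) ^ (1 / p - 1 / 2) * (t / s) ^ (1 / p - 1 / 2)) := by ring
    _ = 1 := by rw [h1, h2]; norm_num

theorem one_le_gammaConst {k : ℕ} (hk : 1 ≤ k) (hA : 0 < lowerConst A k) :
    1 ≤ gammaConst A k := by
  rw [gammaConst, le_div_iff₀ (by positivity), one_mul]
  exact pow_le_pow_left₀ hA.le (lowerConst_le_upperConst A hk hA) 2

end

end SchattenRecovery

end

/-! ### Assembly of exact and stable recovery. -/

open SchattenRecovery in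
theorem mainTheorem7 :
    ∃ C₁ C₂ : ℝ → ℝ → ℝ → ℝ,
      ∀ (p : ℝ), 0 < p → p ≤ 1 →
      ∀ (N m s t : ℕ), 1 ≤ s → s ≤ t →
      ∀ A : Matrix (Fin N) (Fin N) ℝ →ₗ[ℝ] EuclideanSpace ℝ (Fin m),
        0 < SchattenRecovery.lowerConst A (2 * t) →
        SchattenRecovery.gammaConst A (2 * t) - 1
          < 4 * (Real.sqrt 2 - 1) * ((t : ℝ) / (s : ℝ)) ^ (1 / p - 1 / 2) →
        (∀ X : Matrix (Fin N) (Fin N) ℝ, X.rank ≤ s →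
          ∀ X' : Matrix (Fin N) (Fin N) ℝ,
            SchattenRecovery.IsSolution p A (A X) X' ↔ X' = X) ∧
        (∀ X : Matrix (Fin N) (Fin N) ℝ,
          (∃ X' : Matrix (Fin N) (Fin N) ℝ, SchattenRecovery.IsSolution p A (A X) X') ∧
          ∀ X' : Matrix (Fin N) (Fin N) ℝ, SchattenRecovery.IsSolution p A (A X) X' →
            SchattenRecovery.schattenNorm p (X - X')
              ≤ C₁ p (SchattenRecovery.gammaConst A (2 * t)) ((s : ℝ) / (t : ℝ))
                  * SchattenRecovery.rankError p s X ∧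
            SchattenRecovery.schattenNorm 2 (X - X')
              ≤ C₂ p (SchattenRecovery.gammaConst A (2 * t)) ((s : ℝ) / (t : ℝ))
                  * (SchattenRecovery.rankError p s X / (t : ℝ) ^ (1 / p - 1 / 2))) := by
  -- With λ the null space constant, 2/(1 - λ) bounds tail(V) by tail(X), and 1 + λ passes from the
  -- tail of V to the whole. C₂ uses instead the ℓ₂ bound for kernel elements in terms of the tail.
  refine ⟨fun p γ r => ((1 + nullSpaceConst p γ r) * (2 / (1 - nullSpaceConst p γ r))) ^ (1 / p),
    fun p γ r => (1 + (1 + √2) / 2 * (γ - 1)) * (2 / (1 - nullSpaceConst p γ r)) ^ (1 / p), ?_⟩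
  intro p hp hp1 N m s t hs hst A hA hγ
  have ht : 0 < t := by omega
  have hs' : (0 : ℝ) < s := by exact_mod_cast hs
  have ht' : (0 : ℝ) < t := by exact_mod_cast ht
  have hγ1 := one_le_gammaConst A (by omega) hA
  have hγ0 : 0 ≤ gammaConst A (2 * t) - 1 := by linarith
  have hlam1 := nullSpaceConst_lt_one hp hs' ht' hγ1 hγ
  have hlam0 : 0 ≤ nullSpaceConst p (gammaConst A (2 * t)) (s / t) := by
    unfold nullSpaceConst
    positivity
  have hnull : ∀ V : Matrix (Fin N) (Fin N) ℝ, A V = 0 → schattenHead p s V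
      ≤ nullSpaceConst p (gammaConst A (2 * t)) (s / t) * schattenTail p s V := fun V hV =>
    (schattenHead_le_of_map_eq_zero A hst ht hA hp hp1 hV).1
  set lam := nullSpaceConst p (gammaConst A (2 * t)) (s / t)
  have hker : ∀ {X X' : Matrix (Fin N) (Fin N) ℝ}, IsSolution p A (A X) X' → A (X - X') = 0 := by
    intro X X' h
    rw [map_sub, h.1, sub_self]
  have htail : ∀ {X X' : Matrix (Fin N) (Fin N) ℝ}, IsSolution p A (A X) X' →
      schattenTail p s (X - X') ≤ 2 / (1 - lam) * schattenTail p s X := by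
    intro X X' h
    have h1 := schattenTail_sub_le hp hp1 s ((schattenNorm_le_iff hp _ _).1 (h.2 X rfl))
    have h2 := hnull _ (hker h)
    rw [div_mul_eq_mul_div, le_div_iff₀ (by linarith)]
    linarith
  have hexact : ∀ {X X' : Matrix (Fin N) (Fin N) ℝ}, X.rank ≤ s → IsSolution p A (A X) X' →
      X' = X := by
    intro X X' hX h
    have h1 := htail h
    rw [schattenTail_eq_zero hp hX, mul_zero] at h1
    have h2 := le_antisymm h1 (schattenTail_nonneg _ _ _)
    have h3 := hnull _ (hker h)
    rw [h2, mul_zero] at h3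
    have h4 := le_antisymm h3 (schattenHead_nonneg _ _ _)
    have h5 := schattenHead_add_schattenTail p s (X - X')
    rw [h2, h4, add_zero] at h5
    exact (sub_eq_zero.1 (eq_zero_of_schattenPow_eq_zero hp hp1 h5.symm)).symm
  refine ⟨fun X hX X' => ⟨hexact hX, ?_⟩, fun X => ⟨exists_isSolution A hp hp1 X, ?_⟩⟩
  · rintro rfl
    -- That a matrix of rank at most s is itself a solution comes indirectly: some solution exists,
    -- and every solution equals that matrix.
    obtain ⟨X₀, hX₀⟩ := exists_isSolution A hp hp1 X'
    have := hexact hX hX₀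
    rwa [this] at hX₀
  intro X' h
  have h1 := htail h
  have h2 := hnull _ (hker h)
  have hρ := rpow_schattenTail_le_rankError hp s X
  have hτ := schattenTail_nonneg p s X
  have hlam' : 0 < 1 - lam := by linarith
  constructor
  · calc schattenNorm p (X - X')
        ≤ ((1 + lam) * (2 / (1 - lam)) * schattenTail p s X) ^ (1 / p) := by
          refine Real.rpow_le_rpow (schattenPow_nonneg p _) ?_ (by positivity)
          change schattenPow p (X - X') ≤ _
          rw [← schattenHead_add_schattenTail p s (X - X')]
          calc _ ≤ (1 + lam) * schattenTail p s (X - X') := by linarith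
            _ ≤ (1 + lam) * (2 / (1 - lam) * schattenTail p s X) := by gcongr
            _ = _ := by ring
      _ = ((1 + lam) * (2 / (1 - lam))) ^ (1 / p) * schattenTail p s X ^ (1 / p) :=
          Real.mul_rpow (by positivity) hτ
      _ ≤ _ := by gcongr
  · calc schattenNorm 2 (X - X')
        ≤ (1 + (1 + √2) / 2 * (gammaConst A (2 * t) - 1))
          * (schattenTail p s (X - X') ^ (1 / p) * (t : ℝ) ^ (1 / 2 - 1 / p)) :=
          (schattenHead_le_of_map_eq_zero A hst ht hA hp hp1 (hker h)).2
      _ ≤ (1 + (1 + √2) / 2 * (gammaConst A (2 * t) - 1))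
          * ((2 / (1 - lam)) ^ (1 / p) * rankError p s X * (t : ℝ) ^ (1 / 2 - 1 / p)) := by
          gcongr
          refine (Real.rpow_le_rpow (schattenTail_nonneg _ _ _) h1 (by positivity)).trans ?_
          rw [Real.mul_rpow (by positivity) hτ]
          gcongr
      _ = _ := by
          rw [show (1 : ℝ) / 2 - 1 / p = -(1 / p - 1 / 2) by ring, Real.rpow_neg ht'.le]
          ring
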